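/- Let $d\ge 0$ and $m\ge 0$ be integers. A multi-index $\alpha=(\alpha_1,\dots,\alpha_\ell)$ is an unordered collection of elements of $\{1,\dots,d\}$ with repetitions allowed; $|\alpha|=\ell\ge0$ is its length. For processes $W_1,\dots,W_d$ put $W_\alpha=W_{\alpha_1}\cdots W_{\alpha_\ell}$, with $W_\emptyset=1$. For $f:[0,1]\to\mathbb R$ let $$\|f\|_{L^\infty}=\sup_{t\in[0,1]}|f(t)|,\qquad \|f\|_{\mathrm{Lip}}=\sup_{s\neq t\in[0,1]}\frac{|f(s)-f(t)|}{|s-t|}\in[0,\infty].$$ There exist sets $\mathrm{Osc}^m_\varepsilon$, $0<\varepsilon\le1$, of $\mathbb R^d$-valued paths, and constants $C_p$, $p\ge1$, all depending only on $m$ and on the number $d$ of Wiener processes, with the following property. Let $W_1,\dots,W_d$ be independent standard real Wiener processes on any probability space $(\Omega,\mathbf P)$. Then: 1. For every $\varepsilon\in(0,1]$ the set $\{W\in \mathrm{Osc}^m_\varepsilon\}$ is an event (measurable for the completion of $\mathbf P$), and $\mathbf P(W\in\mathrm{Osc}^m_\varepsilon)\le C_p\,\varepsilon^p$ for every $p\ge1$.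 2. Let $(A_\alpha)_\alpha$ be any family of (not necessarily adapted) real stochastic processes on $\Omega$, indexed by the multi-indices, such that $A_\alpha=0$ whenever $|\alpha|>m$, and set $Z_A(t)=\sum_\alpha A_\alpha(t)W_\alpha(t)$. Then for every $\varepsilon\in(0,1]$ the following implication holds at every $\omega\in\Omega$ with $W(\omega)\notin\mathrm{Osc}^m_\varepsilon$: $$\|Z_A\|_{L^\infty}\le\varepsilon\ \Longrightarrow\ \Bigl(\ \sup_\alpha\|A_\alpha\|_{L^\infty}\le\varepsilon^{3^{-m}}\quad\text{or}\quad \sup_\alpha\|A_\alpha\|_{\mathrm{Lip}}\ge\varepsilon^{-3^{-(m+1)}}\ \Bigr).$$ -/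

import Mathlib

open MeasureTheory ProbabilityTheory Set
open scoped NNReal ENNReal

namespace WienerPoly

/-- The supremum norm on `[0,1]` of a real function of time, with values in `[0,∞]`. -/
noncomputable def supNorm (f : ℝ≥0 → ℝ) : ℝ≥0∞ :=
  ⨆ t ∈ Icc (0 : ℝ≥0) 1, ‖f t‖ₑ

/-- The best Lipschitz constant on `[0,1]` of a real function of time, with values in `[0,∞]`
(the quotient is `0 / 0 = 0` for `s = t`). -/
noncomputable def lipNorm (f : ℝ≥0 → ℝ) : ℝ≥0∞ :=
  ⨆ s ∈ Icc (0 : ℝ≥0) 1, ⨆ t ∈ Icc (0 : ℝ≥0) 1, edist (f s) (f t) / edist s t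

theorem supNorm_le_iff {f : ℝ≥0 → ℝ} {c : ℝ} (hc : 0 ≤ c) :
    supNorm f ≤ ENNReal.ofReal c ↔ ∀ t : ℝ≥0, t ≤ 1 → |f t| ≤ c := by
  simp [supNorm, Real.enorm_eq_ofReal_abs, ENNReal.ofReal_le_ofReal_iff hc]

theorem lipNorm_le_iff {f : ℝ≥0 → ℝ} {K : ℝ≥0} :
    lipNorm f ≤ K ↔ LipschitzOnWith K f (Icc 0 1) := by
  simp only [lipNorm, iSup_le_iff, LipschitzOnWith]
  refine forall₂_congr fun s _ => forall₂_congr fun t _ => ?_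
  rcases eq_or_ne s t with rfl | h
  · simp
  · exact ENNReal.div_le_iff (edist_pos.2 h).ne' (edist_ne_top s t)

/-- The monomial `W_α = W_{α₁} ⋯ W_{α_ℓ}` at a point of `ℝᵈ`. A multi-index is an unordered
collection of elements of `{1, …, d}` with repetitions allowed, that is, a multiset; its length
`|α|` is its cardinality, and the empty product is `1`. -/
noncomputable def monomial {d : ℕ} (x : Fin d → ℝ) (α : Multiset (Fin d)) : ℝ :=
  (α.map x).prod

/-- A path of the Wiener polynomial `Z_A(t) = ∑_α A_α(t) W_α(t)`, for a path `w` of the driving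
processes and paths `a α` of the coefficients. The sum has finitely many nonzero terms as soon as
`a α` vanishes for all `α` of large length, see `finite_support`. -/
noncomputable def wienerPolynomial {d : ℕ} (w : Fin d → ℝ≥0 → ℝ)
    (a : Multiset (Fin d) → ℝ≥0 → ℝ) (t : ℝ≥0) : ℝ :=
  ∑ᶠ α : Multiset (Fin d), a α t * monomial (fun k => w k t) α

theorem finite_card_le (d m : ℕ) : {α : Multiset (Fin d) | Multiset.card α ≤ m}.Finite := by
  refine (Set.finite_Iic (m • (Finset.univ : Finset (Fin d)).val)).subset fun α hα => ?_
  rw [mem_Iic, Multiset.le_iff_count]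
  intro k
  rw [Multiset.count_nsmul, Multiset.count_eq_one_of_mem Finset.univ.nodup (Finset.mem_univ k)]
  simpa using (Multiset.count_le_card k α).trans hα

theorem finite_support {d m : ℕ} (w : Fin d → ℝ≥0 → ℝ) (a : Multiset (Fin d) → ℝ≥0 → ℝ)
    (ha : ∀ α, m < Multiset.card α → a α = 0) (t : ℝ≥0) :
    (Function.support fun α => a α t * monomial (fun k => w k t) α).Finite := by
  refine (finite_card_le d m).subset fun α hα => ?_
  by_contra h
  exact hα (by simp [ha α (not_le.1 h)])

/-- The family `(H ε)`, `0 < ε ≤ 1`, is a family of negligible events, with constants `C p`: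
`P (H ε) ≤ C p * ε ^ p` for all `p ≥ 1` and all `0 < ε ≤ 1`. Events are sets that are measurable
for the completion of `P`. -/
def IsNegligible {Ω : Type*} [MeasurableSpace Ω] (P : Measure Ω) (C : ℝ → ℝ)
    (H : ℝ → Set Ω) : Prop :=
  ∀ ε : ℝ, 0 < ε → ε ≤ 1 →
    NullMeasurableSet (H ε) P ∧ ∀ p : ℝ, 1 ≤ p → P (H ε) ≤ ENNReal.ofReal (C p * ε ^ p)

/-- The statement `Φ ε ω` holds modulo the family `H`: for every `0 < ε ≤ 1` it holds on the
complement of `H ε`. -/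
def HoldsModulo {Ω : Type*} (H : ℝ → Set Ω) (Φ : ℝ → Ω → Prop) : Prop :=
  ∀ ε : ℝ, 0 < ε → ε ≤ 1 → ∀ ω ∉ H ε, Φ ε ω

/-- `W₁, …, W_d` are independent standard real Wiener processes. -/
structure IsWienerFamily {Ω : Type*} [MeasurableSpace Ω] {d : ℕ} (P : Measure Ω)
    (W : Fin d → ℝ≥0 → Ω → ℝ) : Prop where
  isBrownian : ∀ k, IsBrownianReal (W k) P
  indep : iIndepFun (fun k ω t => W k t ω) P

end WienerPoly

namespace WienerPoly

/-! Off a rare set, Wiener paths are regular: on dyadic intervals of length `2 ^ (-n)` they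
oscillate by at most about `2 ^ (-n / 2)`, and among the `K` subintervals some increment points
almost exactly along any prescribed axis. For such a path everything is deterministic. If `Z` is
small and the coefficients are Lipschitz, a Taylor expansion makes the pairing of the gradient of
`Z`, taken at one fixed time, with every increment in the block small; since the increments nearly
span all directions, each partial derivative is small
(`IsRegular.abs_wienerPolynomial_derivFamily_le`).

A partial derivative is again a Wiener polynomial, of lower degree, so one inducts
(`IsRegular.abs_coeff_le`). With `|Z| ≤ ε ^ θ` and Lipschitz constants of order `ε ^ (-lam)`, the
best block length turns `θ` into `(θ - lam) / 2`, up to a small loss `c` that pays for constants and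
powers of `K`. Dividing by the supremum `M` of the coefficients and assuming both alternatives fail,
`m` halvings still leave a positive exponent, so all coefficients are at most `M / 2`, a
contradiction (`IsRegular.iSup_supNorm_le_or`).

Here `K` is a tiny negative power of `ε`. Gaussian moments and chaining control the oscillations,
and `K` independent trials control nondegeneracy, so irregularity has probability below every power
of `1 / K`, hence of `ε` (`measure_not_isRegular_le`, `exists_irregularity_bound`). -/

variable {d : ℕ}

/-! ### Monomials: size, variation and Taylor expansion -/

@[simp] theorem monomial_zero (x : Fin d → ℝ) : monomial x 0 = 1 := by simp [monomial]

@[simp] theorem monomial_cons (x : Fin d → ℝ) (k : Fin d) (α : Multiset (Fin d)) :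
    monomial x (k ::ₘ α) = x k * monomial x α := by simp [monomial]

theorem abs_monomial_le {x : Fin d → ℝ} {R : ℝ} (hx : ∀ k, |x k| ≤ R) (α : Multiset (Fin d)) :
    |monomial x α| ≤ R ^ Multiset.card α := by
  induction α using Multiset.induction_on with
  | empty => simp
  | cons k α ih =>
    rw [monomial_cons, abs_mul, Multiset.card_cons, pow_succ']
    exact mul_le_mul (hx k) ih (abs_nonneg _) ((abs_nonneg _).trans (hx k))

theorem abs_monomial_sub_le {x z : Fin d → ℝ} {R ω : ℝ} (hR : 1 ≤ R) (hx : ∀ k, |x k| ≤ R)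
    (hz : ∀ k, |z k| ≤ R) (hxz : ∀ k, |x k - z k| ≤ ω) (α : Multiset (Fin d)) :
    |monomial x α - monomial z α| ≤ Multiset.card α * R ^ Multiset.card α * ω := by
  induction α using Multiset.induction_on with
  | empty => simp
  | cons k α ih =>
    have hω : 0 ≤ ω := (abs_nonneg _).trans (hxz k)
    have h0 : 0 ≤ R := by linarith
    simp only [monomial_cons, Multiset.card_cons, Nat.cast_add, Nat.cast_one, pow_succ']
    set n := Multiset.card α
    have e : x k * monomial x α - z k * monomial z α
        = x k * (monomial x α - monomial z α) + (x k - z k) * monomial z α := by ring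
    have h1 : |x k * (monomial x α - monomial z α)| ≤ R * (n * R ^ n * ω) := by
      rw [abs_mul]; exact mul_le_mul (hx k) ih (abs_nonneg _) h0
    have h2 : |(x k - z k) * monomial z α| ≤ ω * R ^ n := by
      rw [abs_mul]; exact mul_le_mul (hxz k) (abs_monomial_le hz α) (abs_nonneg _) hω
    have h3 : ω * R ^ n ≤ R * (ω * R ^ n) := le_mul_of_one_le_left (by positivity) hR
    rw [e]
    calc _ ≤ _ := abs_add_le _ _
      _ ≤ R * (n * R ^ n * ω) + R * (ω * R ^ n) := by linarith
      _ = _ := by ring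

/-- The partial derivative of a monomial in the direction `k`. -/
noncomputable def monomialDeriv (x : Fin d → ℝ) (k : Fin d) (α : Multiset (Fin d)) : ℝ :=
  α.count k * monomial x (α.erase k)

theorem monomialDeriv_cons (x : Fin d → ℝ) (k l : Fin d) (α : Multiset (Fin d)) :
    monomialDeriv x l (k ::ₘ α)
      = x k * monomialDeriv x l α + if l = k then monomial x α else 0 := by
  unfold monomialDeriv
  by_cases h : l = k
  · subst h
    rw [Multiset.count_cons_self, Multiset.erase_cons_head, if_pos rfl]
    by_cases hl : l ∈ α
    · conv_rhs => rw [← Multiset.cons_erase hl]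
      rw [Multiset.erase_cons_head, Multiset.count_cons_self, monomial_cons]
      conv_lhs => rw [← Multiset.cons_erase hl]
      rw [Multiset.count_cons_self, monomial_cons]
      push_cast; ring
    · simp [Multiset.count_eq_zero_of_notMem hl]
  · rw [Multiset.count_cons_of_ne h, Multiset.erase_cons_tail _ (Ne.symm h), if_neg h,
      monomial_cons]
    ring

/-- The gradient is taken at a third point `z`, not at an endpoint: all increments inside one block
can then be tested against the same gradient vector. The error stays quadratic because `x` and `y`
are both `ω`-close to `z`. -/
theorem abs_monomial_taylor_le {x y z : Fin d → ℝ} {R ω : ℝ} (hR : 1 ≤ R) (hx : ∀ k, |x k| ≤ R)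
    (hy : ∀ k, |y k| ≤ R) (hz : ∀ k, |z k| ≤ R) (hxz : ∀ k, |x k - z k| ≤ ω)
    (hyz : ∀ k, |y k - z k| ≤ ω) (α : Multiset (Fin d)) :
    |monomial y α - monomial x α - ∑ k, monomialDeriv z k α * (y k - x k)|
      ≤ 2 * (Multiset.card α) ^ 2 * R ^ Multiset.card α * ω ^ 2 := by
  induction α using Multiset.induction_on with
  | empty => simp [monomialDeriv]
  | cons k α ih =>
    have hω : 0 ≤ ω := (abs_nonneg _).trans (hxz k)
    have h0 : 0 ≤ R := by linarith
    simp only [monomial_cons, monomialDeriv_cons, Multiset.card_cons, Nat.cast_add, Nat.cast_one,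
      pow_succ' R, add_mul, Finset.sum_add_distrib, ite_mul, zero_mul, Finset.sum_ite_eq',
      Finset.mem_univ, if_true, mul_assoc (z k), ← Finset.mul_sum]
    set n := Multiset.card α
    set S := ∑ i, monomialDeriv z i α * (y i - x i)
    have e : y k * monomial y α - x k * monomial x α - (z k * S + monomial z α * (y k - x k))
        = z k * (monomial y α - monomial x α - S) + (y k - z k) * (monomial y α - monomial z α)
          - (x k - z k) * (monomial x α - monomial z α) := by ring
    have h1 : |z k * (monomial y α - monomial x α - S)| ≤ R * (2 * n ^ 2 * R ^ n * ω ^ 2) := by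
      rw [abs_mul]; exact mul_le_mul (hz k) ih (abs_nonneg _) h0
    have h2 : |(y k - z k) * (monomial y α - monomial z α)| ≤ ω * (n * R ^ n * ω) := by
      rw [abs_mul]
      exact mul_le_mul (hyz k) (abs_monomial_sub_le hR hy hz hyz α) (abs_nonneg _) hω
    have h3 : |(x k - z k) * (monomial x α - monomial z α)| ≤ ω * (n * R ^ n * ω) := by
      rw [abs_mul]
      exact mul_le_mul (hxz k) (abs_monomial_sub_le hR hx hz hxz α) (abs_nonneg _) hω
    have h4 : n * R ^ n * ω ^ 2 ≤ R * (n * R ^ n * ω ^ 2) :=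
      le_mul_of_one_le_left (by positivity) hR
    have h5 : 0 ≤ R * (R ^ n * ω ^ 2) := by positivity
    have h6 : 0 ≤ R * (n * R ^ n * ω ^ 2) := by positivity
    rw [e]
    have h7 := (norm_sub_le (z k * (monomial y α - monomial x α - S)
      + (y k - z k) * (monomial y α - monomial z α)) _).trans
      (add_le_add_left (norm_add_le _ _) ‖(x k - z k) * (monomial x α - monomial z α)‖)
    simp only [Real.norm_eq_abs] at h7
    calc _ ≤ _ := h7
      _ ≤ R * (2 * n ^ 2 * R ^ n * ω ^ 2) + R * (n * R ^ n * ω ^ 2) + R * (n * R ^ n * ω ^ 2) := by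
        nlinarith
      _ ≤ _ := by nlinarith

/-! ### Wiener polynomials and their partial derivatives -/

/-- The multi-indices of length at most `m`. -/
noncomputable def indices (d m : ℕ) : Finset (Multiset (Fin d)) := (finite_card_le d m).toFinset

@[simp] theorem mem_indices {m : ℕ} {α : Multiset (Fin d)} :
    α ∈ indices d m ↔ Multiset.card α ≤ m := by simp [indices]

theorem wienerPolynomial_eq_sum {m : ℕ} (w : Fin d → ℝ≥0 → ℝ) {a : Multiset (Fin d) → ℝ≥0 → ℝ}
    (ha : ∀ α, m < Multiset.card α → a α = 0) (t : ℝ≥0) :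
    wienerPolynomial w a t = ∑ α ∈ indices d m, a α t * monomial (fun k => w k t) α := by
  refine finsum_eq_sum_of_support_subset _ fun α hα => ?_
  rw [Finset.mem_coe, mem_indices]
  by_contra h
  exact hα (by simp [ha α (not_le.1 h)])

theorem wienerPolynomial_eq_of_degree_zero (w : Fin d → ℝ≥0 → ℝ)
    {a : Multiset (Fin d) → ℝ≥0 → ℝ} (ha : ∀ α, 0 < Multiset.card α → a α = 0) (t : ℝ≥0) :
    wienerPolynomial w a t = a 0 t := by
  rw [wienerPolynomial_eq_sum w ha, Finset.sum_eq_single 0]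
  · simp
  · intro β hβ hβ0
    rw [mem_indices, Nat.le_zero, Multiset.card_eq_zero] at hβ
    exact absurd hβ hβ0
  · simp

/-- The coefficients of the partial derivative of a polynomial in the direction `k`. -/
def derivFamily (k : Fin d) (a : Multiset (Fin d) → ℝ≥0 → ℝ) (β : Multiset (Fin d)) (t : ℝ≥0) : ℝ :=
  (β.count k + 1) * a (k ::ₘ β) t

theorem derivFamily_eq_zero {m : ℕ} {a : Multiset (Fin d) → ℝ≥0 → ℝ}
    (ha : ∀ α, m + 1 < Multiset.card α → a α = 0) (k : Fin d) (β : Multiset (Fin d))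
    (hβ : m < Multiset.card β) : derivFamily k a β = 0 := by
  ext t
  simp [derivFamily, ha (k ::ₘ β) (by simpa using hβ)]

/-- Reindexing by `α = k ::ₘ β`: multi-indices that do not contain `k` have derivative zero, and the
multiplicity of `k` in `α` is the factor built into `derivFamily`. -/
theorem wienerPolynomial_derivFamily {m : ℕ} (w : Fin d → ℝ≥0 → ℝ)
    {a : Multiset (Fin d) → ℝ≥0 → ℝ} (ha : ∀ α, m < Multiset.card α → a α = 0) (k : Fin d)
    (t : ℝ≥0) :
    wienerPolynomial w (derivFamily k a) t
      = ∑ α ∈ indices d m, a α t * monomialDeriv (fun k => w k t) k α := by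
  have hf : (Function.support fun α => a α t * monomialDeriv (fun k => w k t) k α)
      ⊆ Set.range (k ::ₘ ·) := fun α hα => by
    refine ⟨α.erase k, Multiset.cons_erase ?_⟩
    by_contra h
    exact hα (by simp [monomialDeriv, Multiset.count_eq_zero_of_notMem h])
  have h1 : wienerPolynomial w (derivFamily k a) t
      = ∑ᶠ β, (fun α => a α t * monomialDeriv (fun k => w k t) k α) (k ::ₘ β) := by
    refine finsum_congr fun β => ?_
    simp [derivFamily, monomialDeriv]; ring
  rw [h1, ← finsum_mem_range (g := (k ::ₘ ·))
    (f := fun α => a α t * monomialDeriv (fun k => w k t) k α) fun _ _ => (Multiset.cons_inj_right k).1]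
  rw [← finsum_mem_inter_support, Set.inter_eq_right.2 hf, finsum_mem_support]
  refine finsum_eq_sum_of_support_subset _ fun α hα => ?_
  rw [Finset.mem_coe, mem_indices]
  by_contra h
  exact hα (by simp [ha α (not_le.1 h)])

/-- Freezing the coefficients at time `t` costs their variation `b`; expanding the monomials around
`w t` costs `ω ^ 2`. What remains of `Z u - Z s` is the gradient at `t` paired with the increment of
the path. -/
theorem abs_sum_derivFamily_mul_increment_le {m : ℕ} {w : Fin d → ℝ≥0 → ℝ}
    {a : Multiset (Fin d) → ℝ≥0 → ℝ} (ha : ∀ α, m < Multiset.card α → a α = 0)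
    {R ω D b e : ℝ} {s u t : ℝ≥0} (hR : 1 ≤ R)
    (hs : ∀ k, |w k s| ≤ R) (hu : ∀ k, |w k u| ≤ R) (ht : ∀ k, |w k t| ≤ R)
    (hst : ∀ k, |w k s - w k t| ≤ ω) (hut : ∀ k, |w k u - w k t| ≤ ω)
    (hD : ∀ α, |a α t| ≤ D) (has : ∀ α, |a α s - a α t| ≤ b) (hau : ∀ α, |a α u - a α t| ≤ b)
    (hZs : |wienerPolynomial w a s| ≤ e) (hZu : |wienerPolynomial w a u| ≤ e) :
    |∑ k, wienerPolynomial w (derivFamily k a) t * (w k u - w k s)|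
      ≤ 2 * e + (indices d m).card * (2 * b * R ^ m + 2 * m ^ 2 * D * R ^ m * ω ^ 2) := by
  have h0 : 0 ≤ R := by linarith
  have hb : 0 ≤ b := (abs_nonneg _).trans (has 0)
  have hD0 : 0 ≤ D := (abs_nonneg _).trans (hD 0)
  set x := fun k => w k s
  set y := fun k => w k u
  set z := fun k => w k t
  have key : ∑ k, wienerPolynomial w (derivFamily k a) t * (w k u - w k s)
      = (wienerPolynomial w a u - wienerPolynomial w a s) - ∑ α ∈ indices d m,
        ((a α u - a α t) * monomial y α - (a α s - a α t) * monomial x α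
          + a α t * (monomial y α - monomial x α - ∑ k, monomialDeriv z k α * (y k - x k))) := by
    simp only [wienerPolynomial_derivFamily w ha, wienerPolynomial_eq_sum w ha, Finset.sum_mul]
    rw [Finset.sum_comm, ← Finset.sum_sub_distrib, ← Finset.sum_sub_distrib]
    refine Finset.sum_congr rfl fun α _ => ?_
    have : ∑ k, a α t * monomialDeriv z k α * (w k u - w k s)
        = a α t * ∑ k, monomialDeriv z k α * (y k - x k) := by
      rw [Finset.mul_sum]; exact Finset.sum_congr rfl fun k _ => by ring
    rw [this]; ring
  have hterm : ∀ α ∈ indices d m,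
      |(a α u - a α t) * monomial y α - (a α s - a α t) * monomial x α
        + a α t * (monomial y α - monomial x α - ∑ k, monomialDeriv z k α * (y k - x k))|
      ≤ 2 * b * R ^ m + 2 * m ^ 2 * D * R ^ m * ω ^ 2 := by
    intro α hα
    rw [mem_indices] at hα
    have hRm : R ^ Multiset.card α ≤ R ^ m := pow_le_pow_right₀ hR hα
    have h1 : |(a α u - a α t) * monomial y α| ≤ b * R ^ m := by
      rw [abs_mul]
      exact mul_le_mul (hau α) ((abs_monomial_le hu α).trans hRm) (abs_nonneg _) hb
    have h2 : |(a α s - a α t) * monomial x α| ≤ b * R ^ m := by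
      rw [abs_mul]
      exact mul_le_mul (has α) ((abs_monomial_le hs α).trans hRm) (abs_nonneg _) hb
    have h3 : |a α t * (monomial y α - monomial x α - ∑ k, monomialDeriv z k α * (y k - x k))|
        ≤ D * (2 * m ^ 2 * R ^ m * ω ^ 2) := by
      rw [abs_mul]
      refine mul_le_mul (hD α) ((abs_monomial_taylor_le hR hs hu ht hst hut α).trans ?_)
        (abs_nonneg _) hD0
      have : (Multiset.card α : ℝ) ≤ m := by exact_mod_cast hα
      gcongr
    have h4 := norm_add_le ((a α u - a α t) * monomial y α - (a α s - a α t) * monomial x α)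
      (a α t * (monomial y α - monomial x α - ∑ k, monomialDeriv z k α * (y k - x k)))
    have h5 := norm_sub_le ((a α u - a α t) * monomial y α) ((a α s - a α t) * monomial x α)
    simp only [Real.norm_eq_abs] at h4 h5
    linarith
  rw [key]
  have h6 := norm_sub_le (wienerPolynomial w a u - wienerPolynomial w a s) (∑ α ∈ indices d m,
        ((a α u - a α t) * monomial y α - (a α s - a α t) * monomial x α
          + a α t * (monomial y α - monomial x α - ∑ k, monomialDeriv z k α * (y k - x k))))
  have h7 := norm_sub_le (wienerPolynomial w a u) (wienerPolynomial w a s)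
  have h8 := (Finset.abs_sum_le_sum_abs _ _).trans (Finset.sum_le_card_nsmul _ _ _ hterm)
  rw [nsmul_eq_mul] at h8
  simp only [Real.norm_eq_abs] at h6 h7
  linarith

/-- A vector is controlled by its scalar products with vectors that, up to small errors, point in
all coordinate directions. -/
theorem abs_le_of_abs_sum_mul_le {ι : Type*} {v : Fin d → ℝ} {Δ : ι → Fin d → ℝ} {q ρ : ℝ}
    (hΔ : ∀ k, ∃ i, 1 ≤ q * |Δ i k| ∧ ∀ l, l ≠ k → 2 * d * (q * |Δ i l|) ≤ 1)
    (hq : 0 ≤ q) (hv : ∀ i, |∑ k, v k * Δ i k| ≤ ρ) (k : Fin d) : |v k| ≤ 2 * q * ρ := by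
  have : Nonempty (Fin d) := ⟨k⟩
  have hd : (0 : ℝ) < d := by exact_mod_cast k.pos
  -- For the largest coordinate `j`, the off-axis terms of a vector pointing along `j` add up to at
  -- most `|v j| / 2` and can be absorbed.
  obtain ⟨j, hj⟩ := Finite.exists_max (fun k => |v k|)
  refine (hj k).trans ?_
  obtain ⟨i, hi, hil⟩ := hΔ j
  have h1 : v j * Δ i j = ∑ k, v k * Δ i k - ∑ l ∈ Finset.univ.erase j, v l * Δ i l := by
    rw [← Finset.add_sum_erase _ _ (Finset.mem_univ j)]; ring
  have h2 : |∑ l ∈ Finset.univ.erase j, q * (v l * Δ i l)| ≤ |v j| / 2 := by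
    refine (Finset.abs_sum_le_sum_abs _ _).trans
      ((Finset.sum_le_card_nsmul _ _ (|v j| / (2 * d)) fun l hl => ?_).trans ?_)
    · have h3 := hil l (Finset.ne_of_mem_erase hl)
      rw [abs_mul, abs_mul, abs_of_nonneg hq, le_div_iff₀ (by positivity)]
      calc q * (|v l| * |Δ i l|) * (2 * d) = |v l| * (2 * d * (q * |Δ i l|)) := by ring
        _ ≤ |v j| * 1 := mul_le_mul (hj l) h3 (by positivity) (abs_nonneg _)
        _ = _ := mul_one _
    · rw [nsmul_eq_mul]
      have : ((Finset.univ.erase j).card : ℝ) ≤ d := by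
        exact_mod_cast (Finset.card_le_univ _).trans (by simp)
      calc _ ≤ (d : ℝ) * (|v j| / (2 * d)) := by gcongr
        _ = _ := by field_simp
  have h4 : |v j| ≤ |q * (v j * Δ i j)| := by
    rw [abs_mul, abs_mul, abs_of_nonneg hq]
    nlinarith [abs_nonneg (v j)]
  rw [h1, mul_sub] at h4
  rw [← Finset.mul_sum] at h2
  have h5 := norm_sub_le (q * ∑ k, v k * Δ i k) (q * ∑ l ∈ Finset.univ.erase j, v l * Δ i l)
  simp only [Real.norm_eq_abs] at h5
  have h6 : |q * ∑ k, v k * Δ i k| ≤ q * ρ := by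
    rw [abs_mul, abs_of_nonneg hq]; exact mul_le_mul_of_nonneg_left (hv i) hq
  linarith

/-! ### Dyadic chaining -/

/-- The dyadic point `j / 2 ^ n`. -/
noncomputable def dyadic (n j : ℕ) : ℝ≥0 := j / 2 ^ n

theorem dyadic_succ_level (n j : ℕ) : dyadic (n + 1) (2 * j) = dyadic n j := by
  simp only [dyadic, pow_succ]; push_cast; field_simp

/-- Telescoping along the dyadic truncations of `t`: refining by one level either keeps the point or
moves it by one dyadic step, so each level contributes at most one increment. -/
theorem abs_sub_dyadic_floor_le {f : ℝ≥0 → ℝ} {n j : ℕ} {H q : ℝ} {t : ℝ≥0} (hH : 0 ≤ H)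
    (hq0 : 0 ≤ q)
    (hf : ∀ r i, i < 2 ^ (n + r) → |f (dyadic (n + r) (i + 1)) - f (dyadic (n + r) i)| ≤ H * q ^ r)
    (hj : j < 2 ^ n) (htj : ⌊t * 2 ^ n⌋₊ = j) (r : ℕ) :
    |f (dyadic (n + r) ⌊t * 2 ^ (n + r)⌋₊) - f (dyadic n j)|
      ≤ H * ∑ l ∈ Finset.range (r + 1), q ^ l := by
  induction r with
  | zero => simp [htj, hH]
  | succ r ih =>
    have hlt : ⌊t * 2 ^ (n + r)⌋₊ < 2 ^ (n + r) := by
      rw [← htj, Nat.floor_lt zero_le] at hj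
      rw [Nat.floor_lt zero_le]
      push_cast at hj ⊢
      rw [pow_add, ← mul_assoc]
      exact mul_lt_mul_of_pos_right hj (pow_pos two_pos r)
    set i := ⌊t * 2 ^ (n + r)⌋₊ with hi
    have hstep : |f (dyadic (n + (r + 1)) ⌊t * 2 ^ (n + (r + 1))⌋₊) - f (dyadic (n + r) i)|
        ≤ H * q ^ (r + 1) := by
      have h1 : (i : ℝ≥0) ≤ t * 2 ^ (n + r) := Nat.floor_le zero_le
      have h2 : t * 2 ^ (n + r) < i + 1 := Nat.lt_floor_add_one _
      have e : t * 2 ^ (n + (r + 1)) = 2 * (t * 2 ^ (n + r)) := by ring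
      have hcase : ⌊t * 2 ^ (n + (r + 1))⌋₊ = 2 * i ∨ ⌊t * 2 ^ (n + (r + 1))⌋₊ = 2 * i + 1 := by
        have h3 : 2 * i ≤ ⌊t * 2 ^ (n + (r + 1))⌋₊ := by
          rw [Nat.le_floor_iff zero_le, e]; push_cast; gcongr
        have h4 : ⌊t * 2 ^ (n + (r + 1))⌋₊ < 2 * i + 2 := by
          rw [Nat.floor_lt zero_le, e]; push_cast
          calc 2 * (t * 2 ^ (n + r)) < 2 * (i + 1) := by gcongr
            _ = _ := by ring
        omega
      rw [← dyadic_succ_level (n + r) i]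
      rcases hcase with h | h
      · rw [h]; simp only [add_assoc, sub_self, abs_zero]; positivity
      · rw [h]
        refine hf (r + 1) (2 * i) ?_
        rw [← add_assoc, pow_succ]; omega
    rw [Finset.sum_range_succ, mul_add]
    have h5 := abs_add_le (f (dyadic (n + (r + 1)) ⌊t * 2 ^ (n + (r + 1))⌋₊) - f (dyadic (n + r) i))
      (f (dyadic (n + r) i) - f (dyadic n j))
    rw [sub_add_sub_cancel] at h5
    linarith

theorem tendsto_dyadic_floor (n : ℕ) (t : ℝ≥0) :
    Filter.Tendsto (fun r => dyadic (n + r) ⌊t * 2 ^ (n + r)⌋₊) Filter.atTop (nhds t) := by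
  have h1 : Filter.Tendsto (fun x : ℝ => (⌊(t : ℝ) * x⌋₊ : ℝ) / x) Filter.atTop (nhds (t : ℝ)) :=
    tendsto_nat_floor_mul_div_atTop t.2
  have h2 : Filter.Tendsto (fun k : ℕ => (2 : ℝ) ^ k) Filter.atTop Filter.atTop :=
    tendsto_pow_atTop_atTop_of_one_lt one_lt_two
  have h3 : Filter.Tendsto (fun r => n + r) Filter.atTop Filter.atTop :=
    Filter.tendsto_atTop_mono (fun r => Nat.le_add_left r n) Filter.tendsto_id
  rw [← NNReal.tendsto_coe]
  refine (h1.comp (h2.comp h3)).congr fun r => ?_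
  have h4 (x : ℝ≥0) : ⌊(x : ℝ)⌋₊ = ⌊x⌋₊ := by
    rw [Nat.floor_eq_iff x.coe_nonneg]
    exact_mod_cast (⟨Nat.floor_le zero_le, Nat.lt_floor_add_one x⟩ : _ ∧ _)
  simp only [Function.comp, dyadic]
  push_cast
  rw [← h4]
  push_cast
  rfl

theorem abs_sub_dyadic_le {f : ℝ≥0 → ℝ} (hfc : Continuous f) {n j : ℕ} {H q : ℝ} {t : ℝ≥0}
    (hH : 0 ≤ H) (hq0 : 0 ≤ q) (hq1 : q < 1)
    (hf : ∀ r i, i < 2 ^ (n + r) → |f (dyadic (n + r) (i + 1)) - f (dyadic (n + r) i)| ≤ H * q ^ r)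
    (hj : j < 2 ^ n) (h1 : dyadic n j ≤ t) (h2 : t ≤ dyadic n (j + 1)) :
    |f t - f (dyadic n j)| ≤ H * (1 - q)⁻¹ := by
  have h2n : (0 : ℝ≥0) < 2 ^ n := by positivity
  -- At the right endpoint the truncation at level `n` is `j + 1`, not `j`; there the single
  -- increment with `r = 0` suffices.
  rcases h2.eq_or_lt with rfl | h2
  · refine (by simpa using hf 0 j hj : _ ≤ H).trans (le_mul_of_one_le_right hH ?_)
    rw [one_le_inv₀ (by linarith)]; linarith
  · have htj : ⌊t * 2 ^ n⌋₊ = j := by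
      rw [Nat.floor_eq_iff zero_le]
      simp only [dyadic] at h1 h2
      rw [div_le_iff₀ h2n] at h1
      rw [lt_div_iff₀ h2n] at h2
      exact ⟨h1, by exact_mod_cast h2⟩
    have hlim := (((hfc.tendsto t).comp (tendsto_dyadic_floor n t)).sub_const
      (f (dyadic n j))).abs
    refine le_of_tendsto hlim (Filter.Eventually.of_forall fun r => ?_)
    refine (abs_sub_dyadic_floor_le hH hq0 hf hj htj r).trans ?_
    refine mul_le_mul_of_nonneg_left ?_ hH
    rw [← tsum_geometric_of_lt_one hq0 hq1]
    exact (summable_geometric_of_lt_one hq0 hq1).sum_le_tsum _ fun _ _ => by positivity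

/-! ### Regular paths and the gradient estimate -/

/-- A path is regular if at all dyadic scales `2 ^ (-n)` above a threshold its oscillations are of
order `2 ^ (-n / 2)`, up to a factor of order `K`, and its increments over the subdivisions into
`K` pieces of all intervals of length `2 ^ (-n)` are nondegenerate. -/
structure IsRegular (K B : ℕ) (w : Fin d → ℝ≥0 → ℝ) : Prop where
  cont : ∀ k, Continuous (w k)
  zero : ∀ k, w k 0 = 0
  osc : ∀ n, 2 ^ n ≤ K ^ B → ∀ k r j, j < 2 ^ (n + r) →
    |w k (dyadic (n + r) (j + 1)) - w k (dyadic (n + r) j)| ≤ K / √(2 ^ n) * (7 / 8) ^ r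
  nondeg : ∀ n, 2 ^ n ≤ K ^ B → ∀ j < 2 ^ n, ∀ k, ∃ i < K,
    1 ≤ √(2 ^ n * K) * |w k ((j * K + i + 1 : ℕ) / (2 ^ n * K)) - w k ((j * K + i : ℕ) / (2 ^ n * K))|
    ∧ ∀ l, l ≠ k → 2 * d * (√(2 ^ n * K) *
      |w l ((j * K + i + 1 : ℕ) / (2 ^ n * K)) - w l ((j * K + i : ℕ) / (2 ^ n * K))|) ≤ 1

namespace IsRegular

variable {K B : ℕ} {w : Fin d → ℝ≥0 → ℝ}

theorem abs_sub_dyadic_le (hw : IsRegular K B w) {n j : ℕ} (hn : 2 ^ n ≤ K ^ B) (hj : j < 2 ^ n)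
    {t : ℝ≥0} (h1 : dyadic n j ≤ t) (h2 : t ≤ dyadic n (j + 1)) (k : Fin d) :
    |w k t - w k (dyadic n j)| ≤ 8 * (K / √(2 ^ n)) := by
  refine (WienerPoly.abs_sub_dyadic_le (hw.cont k) (H := K / √(2 ^ n)) (q := 7 / 8) (by positivity)
    (by norm_num) (by norm_num) (hw.osc n hn k) hj h1 h2).trans (le_of_eq ?_)
  norm_num; ring

theorem abs_sub_le (hw : IsRegular K B w) {n j : ℕ} (hn : 2 ^ n ≤ K ^ B) (hj : j < 2 ^ n)
    {s t : ℝ≥0} (hs : s ∈ Icc (dyadic n j) (dyadic n (j + 1)))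
    (ht : t ∈ Icc (dyadic n j) (dyadic n (j + 1))) (k : Fin d) :
    |w k s - w k t| ≤ 16 * K / √(2 ^ n) := by
  have h1 := hw.abs_sub_dyadic_le hn hj hs.1 hs.2 k
  have h2 := hw.abs_sub_dyadic_le hn hj ht.1 ht.2 k
  have h3 := norm_sub_le (w k s - w k (dyadic n j)) (w k t - w k (dyadic n j))
  rw [sub_sub_sub_cancel_right] at h3
  simp only [Real.norm_eq_abs] at h3
  refine h3.trans ((add_le_add h1 h2).trans (le_of_eq ?_))
  ring

/-- This is the oscillation bound on the single block of level `n = 0`, which is all of `[0,1]`,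
combined with the start at zero. -/
theorem abs_le (hw : IsRegular K B w) (hK : 1 ≤ K) {t : ℝ≥0} (ht : t ≤ 1) (k : Fin d) :
    |w k t| ≤ 16 * K := by
  have h := hw.abs_sub_le (n := 0) (j := 0) (s := t) (t := 0) (by simpa using Nat.one_le_pow _ _ hK)
    (by simp) (by simpa [dyadic] using ht) (by simp [dyadic]) k
  simpa [hw.zero k] using h

theorem exists_dyadic_block (n : ℕ) {t : ℝ≥0} (ht : t ≤ 1) :
    ∃ j < 2 ^ n, t ∈ Icc (dyadic n j) (dyadic n (j + 1)) := by
  have h2n : (0 : ℝ≥0) < 2 ^ n := by positivity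
  rcases ht.eq_or_lt with rfl | ht
  · refine ⟨2 ^ n - 1, Nat.sub_lt (by positivity) one_pos, ?_, ?_⟩
    · rw [dyadic, div_le_one h2n]
      exact_mod_cast Nat.sub_le _ _
    · rw [Nat.sub_add_cancel Nat.one_le_two_pow, dyadic]
      push_cast
      rw [div_self h2n.ne']
  · refine ⟨⌊t * 2 ^ n⌋₊, ?_, ?_, ?_⟩
    · rw [Nat.floor_lt zero_le]; push_cast
      exact mul_lt_of_lt_one_left h2n ht
    · rw [dyadic, div_le_iff₀ h2n]; exact Nat.floor_le zero_le
    · rw [dyadic, le_div_iff₀ h2n]; push_cast; exact (Nat.lt_floor_add_one _).le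

theorem grid_mem_block {n K j i : ℕ} (hi : i ≤ K) (hK : 1 ≤ K) :
    ((j * K + i : ℕ) / (2 ^ n * K) : ℝ≥0) ∈ Icc (dyadic n j) (dyadic n (j + 1)) := by
  have hK0 : (0 : ℝ≥0) < K := by exact_mod_cast hK
  have hiK : (i : ℝ≥0) ≤ K := by exact_mod_cast hi
  have h2n : (0 : ℝ≥0) < 2 ^ n := by positivity
  constructor
  · rw [dyadic, div_le_div_iff₀ h2n (by positivity)]
    push_cast
    calc (j : ℝ≥0) * (2 ^ n * K) = j * K * 2 ^ n := by ring
      _ ≤ _ := by gcongr; exact le_self_add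
  · rw [dyadic, div_le_div_iff₀ (by positivity) h2n]
    push_cast
    calc ((j : ℝ≥0) * K + i) * 2 ^ n ≤ (j * K + K) * 2 ^ n := by gcongr
      _ = _ := by ring

theorem dist_le_of_mem_block {n j : ℕ} {s t : ℝ≥0} (hs : s ∈ Icc (dyadic n j) (dyadic n (j + 1)))
    (ht : t ∈ Icc (dyadic n j) (dyadic n (j + 1))) : dist s t ≤ 1 / 2 ^ n := by
  have h1 : ((dyadic n j : ℝ≥0) : ℝ) ≤ s := by exact_mod_cast hs.1
  have h2 : (s : ℝ) ≤ (dyadic n (j + 1) : ℝ≥0) := by exact_mod_cast hs.2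
  have h3 : ((dyadic n j : ℝ≥0) : ℝ) ≤ t := by exact_mod_cast ht.1
  have h4 : (t : ℝ) ≤ (dyadic n (j + 1) : ℝ≥0) := by exact_mod_cast ht.2
  have h5 : ((dyadic n (j + 1) : ℝ≥0) : ℝ) = (dyadic n j : ℝ≥0) + 1 / 2 ^ n := by
    simp only [dyadic]; push_cast; ring
  rw [NNReal.dist_eq, abs_sub_le_iff]
  constructor <;> linarith

/-- In the block containing `t`, the `K` increments nearly span all directions after multiplication
by `√(2 ^ n * K)`. Inverting this system costs twice that factor, applied to the Taylor error with
`ω = 16 * K / √(2 ^ n)`. -/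
theorem abs_wienerPolynomial_derivFamily_le (hw : IsRegular K B w) (hK : 1 ≤ K) {m n : ℕ}
    (hn : 2 ^ n ≤ K ^ B) {a : Multiset (Fin d) → ℝ≥0 → ℝ} {D Λ e : ℝ} (hΛ : 0 ≤ Λ)
    (ha : ∀ α, m < Multiset.card α → a α = 0) (hD : ∀ α, ∀ t ≤ 1, |a α t| ≤ D)
    (hL : ∀ α, ∀ s ≤ 1, ∀ t ≤ 1, |a α s - a α t| ≤ Λ * dist s t)
    (hZ : ∀ t ≤ 1, |wienerPolynomial w a t| ≤ e) {t : ℝ≥0} (ht : t ≤ 1) (k : Fin d) :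
    |wienerPolynomial w (derivFamily k a) t| ≤ 2 * √(2 ^ n * K) * (2 * e + (indices d m).card *
      (2 * (Λ * (1 / 2 ^ n)) * (16 * K) ^ m
        + 2 * m ^ 2 * D * (16 * K) ^ m * (16 * K / √(2 ^ n)) ^ 2)) := by
  obtain ⟨j, hj, htj⟩ := exists_dyadic_block n ht
  have hone : dyadic n (j + 1) ≤ 1 := by
    rw [dyadic, div_le_one (by positivity)]; exact_mod_cast hj
  have hK1 : (1 : ℝ) ≤ K := by exact_mod_cast hK
  have hmem (i : Fin K) := grid_mem_block (n := n) (j := j) i.2.le hK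
  have hmem' (i : Fin K) := grid_mem_block (n := n) (j := j) (i := i + 1) i.2 hK
  refine abs_le_of_abs_sum_mul_le (ι := Fin K) (Δ := fun i l => w l ((j * K + i + 1 : ℕ) / (2 ^ n * K))
    - w l ((j * K + i : ℕ) / (2 ^ n * K))) (v := fun k => wienerPolynomial w (derivFamily k a) t)
    (fun k => ?_) (by positivity) (fun i => ?_) k
  · obtain ⟨i, hi, h⟩ := hw.nondeg n hn j hj k
    exact ⟨⟨i, hi⟩, h⟩
  · refine abs_sum_derivFamily_mul_increment_le ha (by linarith)
      (hw.abs_le hK ((hmem i).2.trans hone)) (hw.abs_le hK ((hmem' i).2.trans hone))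
      (hw.abs_le hK ht) (hw.abs_sub_le hn hj (hmem i) htj) (hw.abs_sub_le hn hj (hmem' i) htj)
      (fun α => hD α t ht) (fun α => ?_) (fun α => ?_) (hZ _ ((hmem i).2.trans hone))
      (hZ _ ((hmem' i).2.trans hone))
    · exact (hL α _ ((hmem i).2.trans hone) t ht).trans
        (mul_le_mul_of_nonneg_left (dist_le_of_mem_block (hmem i) htj) hΛ)
    · exact (hL α _ ((hmem' i).2.trans hone) t ht).trans
        (mul_le_mul_of_nonneg_left (dist_le_of_mem_block (hmem' i) htj) hΛ)

end IsRegular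

/-! ### Induction on the degree -/

/-- A constant that dominates all numerical factors in the estimates for Wiener polynomials of
degree `m` in `d` variables. -/
noncomputable def threshold (d m : ℕ) : ℕ :=
  4 * (2 + (indices d m).card * 16 ^ m * (2 + 512 * m ^ 2)) + (m + 1) ^ m

theorem exists_two_pow_between {x : ℝ} (hx : 1 ≤ x) : ∃ n : ℕ, x ≤ 2 ^ n ∧ (2 : ℝ) ^ n ≤ 2 * x := by
  obtain ⟨n, h1, h2⟩ := exists_nat_pow_near hx (one_lt_two)
  exact ⟨n + 1, h2.le, by rw [pow_succ]; linarith⟩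

/-- Taking `2 ^ n` within a factor two of `ε ^ (-(θ + lam))` brings both the variation of the
coefficients, `ε ^ (-lam) * 2 ^ (-n)`, and the quadratic error `2 ^ (-n)` down to order `ε ^ θ`. The
factor `√(2 ^ n)` then costs `ε ^ (-(θ + lam) / 2)`; numerical constants take one power of `K`, and
all powers of `K` go into `ε ^ (-c)`. -/
theorem IsRegular.abs_wienerPolynomial_derivFamily_le_rpow {K B : ℕ} {w : Fin d → ℝ≥0 → ℝ}
    (hw : IsRegular K B w) {m : ℕ} (hK : threshold d m ≤ K) {ε c lam θ D : ℝ} (hε : 0 < ε)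
    (hε1 : ε ≤ 1) (hc : (K : ℝ) ^ (m + 5) ≤ ε ^ (-c)) (hlam : 0 ≤ lam) (hθ : 0 ≤ θ)
    (hB : 2 * ε ^ (-(θ + lam)) ≤ (K : ℝ) ^ B) (hDK : D ≤ K)
    {a : Multiset (Fin d) → ℝ≥0 → ℝ} (ha : ∀ α, m < Multiset.card α → a α = 0)
    (hD : ∀ α, ∀ t ≤ 1, |a α t| ≤ D)
    (hL : ∀ α, ∀ s ≤ 1, ∀ t ≤ 1, |a α s - a α t| ≤ D * ε ^ (-lam) * dist s t)
    (hZ : ∀ t ≤ 1, |wienerPolynomial w a t| ≤ ε ^ θ) {t : ℝ≥0} (ht : t ≤ 1) (k : Fin d) :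
    |wienerPolynomial w (derivFamily k a) t| ≤ ε ^ ((θ - lam) / 2 - c) := by
  set S := (indices d m).card with hS
  have hC : (4 * (2 + S * 16 ^ m * (2 + 512 * m ^ 2)) : ℝ) ≤ K := by
    exact_mod_cast (Nat.le_add_right _ _).trans hK
  have hK1 : (1 : ℝ) ≤ K := by
    refine le_trans ?_ hC
    have : (0 : ℝ) ≤ S * 16 ^ m * (2 + 512 * m ^ 2) := by positivity
    linarith
  have hK1' : 1 ≤ K := by exact_mod_cast hK1
  have hD0 : 0 ≤ D := (abs_nonneg _).trans (hD 0 0 zero_le_one)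
  have hx : 1 ≤ ε ^ (-(θ + lam)) :=
    Real.one_le_rpow_of_pos_of_le_one_of_nonpos hε hε1 (by linarith)
  obtain ⟨n, hn1, hn2⟩ := exists_two_pow_between hx
  have hn : 2 ^ n ≤ K ^ B := by exact_mod_cast hn2.trans hB
  refine (hw.abs_wienerPolynomial_derivFamily_le hK1' hn (mul_nonneg hD0 (by positivity)) ha hD hL
    hZ ht k).trans ?_
  have h2n : (0 : ℝ) < 2 ^ n := by positivity
  have hinv : 1 / (2 : ℝ) ^ n ≤ ε ^ (θ + lam) := by
    rw [div_le_iff₀ h2n]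
    calc (1 : ℝ) = ε ^ (θ + lam) * ε ^ (-(θ + lam)) := by rw [← Real.rpow_add hε]; simp
      _ ≤ _ := by gcongr
  have hinv' : 1 / (2 : ℝ) ^ n ≤ ε ^ θ :=
    hinv.trans (Real.rpow_le_rpow_of_exponent_ge hε hε1 (by linarith))
  have hsq : √((2 : ℝ) ^ n * K) ≤ 2 * K * ε ^ (-(θ + lam) / 2) := by
    rw [Real.sqrt_le_left (by positivity), mul_pow, ← Real.rpow_natCast (ε ^ (-(θ + lam) / 2)),
      ← Real.rpow_mul hε.le]
    have e : -(θ + lam) / 2 * ((2 : ℕ) : ℝ) = -(θ + lam) := by push_cast; ring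
    rw [e]
    calc (2 : ℝ) ^ n * K ≤ 2 * ε ^ (-(θ + lam)) * K := by gcongr
      _ = 2 * K * ε ^ (-(θ + lam)) := by ring
      _ ≤ (2 * K) ^ 2 * ε ^ (-(θ + lam)) := by gcongr; nlinarith
  have hKm : (K : ℝ) ^ (m + 1) ≤ (K : ℝ) ^ (m + 3) := pow_le_pow_right₀ hK1 (by omega)
  have hKm' : (1 : ℝ) ≤ (K : ℝ) ^ (m + 3) := one_le_pow₀ hK1
  have hin : 2 * ε ^ θ + S * (2 * (D * ε ^ (-lam) * (1 / 2 ^ n)) * (16 * K) ^ m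
        + 2 * m ^ 2 * D * (16 * K) ^ m * (16 * K / √(2 ^ n)) ^ 2)
      ≤ ε ^ θ * (K ^ (m + 3) * (2 + S * 16 ^ m * (2 + 512 * m ^ 2))) := by
    have h1 : 2 * (D * ε ^ (-lam) * (1 / 2 ^ n)) * (16 * K) ^ m
        ≤ ε ^ θ * (2 * 16 ^ m * (K : ℝ) ^ (m + 3)) := by
      calc 2 * (D * ε ^ (-lam) * (1 / 2 ^ n)) * (16 * K) ^ m
          ≤ 2 * (K * ε ^ (-lam) * ε ^ (θ + lam)) * (16 * K) ^ m := by gcongr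
        _ = ε ^ (-lam) * ε ^ (θ + lam) * (2 * 16 ^ m * (K : ℝ) ^ (m + 1)) := by ring
        _ = ε ^ θ * (2 * 16 ^ m * (K : ℝ) ^ (m + 1)) := by
          rw [← Real.rpow_add hε]; congr 2; ring
        _ ≤ _ := by gcongr
    have h2 : 2 * m ^ 2 * D * (16 * K) ^ m * (16 * K / √(2 ^ n)) ^ 2
        ≤ ε ^ θ * (512 * m ^ 2 * 16 ^ m * (K : ℝ) ^ (m + 3)) := by
      rw [div_pow, Real.sq_sqrt h2n.le]
      calc 2 * m ^ 2 * D * (16 * K) ^ m * ((16 * K) ^ 2 / 2 ^ n)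
          = D * (1 / 2 ^ n) * (512 * m ^ 2 * 16 ^ m * (K : ℝ) ^ (m + 2)) := by ring
        _ ≤ K * ε ^ θ * (512 * m ^ 2 * 16 ^ m * (K : ℝ) ^ (m + 2)) := by gcongr
        _ = _ := by ring
    have h3 : 2 * ε ^ θ ≤ ε ^ θ * (2 * (K : ℝ) ^ (m + 3)) := by
      nlinarith [Real.rpow_pos_of_pos hε θ]
    calc _ ≤ ε ^ θ * (2 * (K : ℝ) ^ (m + 3)) + S * (ε ^ θ * (2 * 16 ^ m * (K : ℝ) ^ (m + 3))
          + ε ^ θ * (512 * m ^ 2 * 16 ^ m * (K : ℝ) ^ (m + 3))) := by gcongr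
      _ = _ := by ring
  calc _ ≤ 2 * (2 * K * ε ^ (-(θ + lam) / 2))
        * (ε ^ θ * (K ^ (m + 3) * (2 + S * 16 ^ m * (2 + 512 * m ^ 2)))) := by gcongr
    _ = ε ^ (-(θ + lam) / 2) * ε ^ θ
        * (K ^ (m + 4) * (4 * (2 + S * 16 ^ m * (2 + 512 * m ^ 2)))) := by ring
    _ ≤ ε ^ (-(θ + lam) / 2) * ε ^ θ * (K ^ (m + 4) * K) := by gcongr
    _ = ε ^ (-(θ + lam) / 2) * ε ^ θ * K ^ (m + 5) := by ring
    _ ≤ ε ^ (-(θ + lam) / 2) * ε ^ θ * ε ^ (-c) := by gcongr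
    _ = _ := by rw [← Real.rpow_add hε, ← Real.rpow_add hε]; congr 1; ring

/-- The map `θ ↦ (θ - lam) / 2 - c` has fixed point `-μ` with `μ = lam + 2 * c`, so differentiation
simply halves `θ + μ`. The lower bound on `θ + μ` keeps `θ` nonnegative as long as derivatives
remain to be taken; `D * (m + 1) ^ r ≤ K` pays for the multiplicities they produce. -/
theorem IsRegular.abs_coeff_le {K B m : ℕ} {w : Fin d → ℝ≥0 → ℝ} (hw : IsRegular K B w)
    (hK : threshold d m ≤ K) {ε c lam : ℝ} (hε : 0 < ε) (hε1 : ε ≤ 1) (hc0 : 0 ≤ c)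
    (hc : (K : ℝ) ^ (m + 5) ≤ ε ^ (-c)) (hlam : 0 ≤ lam) (hlam1 : lam ≤ 1)
    (hB : 2 * ε ^ (-(2 : ℝ)) ≤ (K : ℝ) ^ B) (r : ℕ) :
    r ≤ m → ∀ (a : Multiset (Fin d) → ℝ≥0 → ℝ) (θ D : ℝ), D * (m + 1) ^ r ≤ K → θ ≤ 1 →
    2 ^ r * (lam + 2 * c) ≤ θ + (lam + 2 * c) →
    (∀ α, r < Multiset.card α → a α = 0) → (∀ α, ∀ t ≤ 1, |a α t| ≤ D) →
    (∀ α, ∀ s ≤ 1, ∀ t ≤ 1, |a α s - a α t| ≤ D * ε ^ (-lam) * dist s t) →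
    (∀ t ≤ 1, |wienerPolynomial w a t| ≤ ε ^ θ) →
    ∀ α, ∀ t ≤ 1, |a α t|
      ≤ (K : ℝ) ^ ((m + 1) * r) * ε ^ ((θ + (lam + 2 * c)) / 2 ^ r - (lam + 2 * c)) := by
  set μ := lam + 2 * c with hμ
  set S := (indices d m).card with hS
  have hC : (4 * (2 + S * 16 ^ m * (2 + 512 * m ^ 2)) : ℝ) ≤ K := by
    exact_mod_cast (Nat.le_add_right _ _).trans hK
  have hS0 : (0 : ℝ) ≤ S * 16 ^ m := by positivity
  have hC' : 1 + S * 16 ^ m ≤ (K : ℝ) := by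
    nlinarith [mul_nonneg hS0 (sq_nonneg (m : ℝ))]
  have hK1 : (1 : ℝ) ≤ K := by linarith
  induction r with
  | zero =>
    intro _ a θ D hD _ _ ha _ _ hZ α t ht
    have hZ0 := wienerPolynomial_eq_of_degree_zero w ha t
    simp only [mul_zero, pow_zero, one_mul, div_one, add_sub_cancel_right]
    by_cases hα : α = 0
    · rw [hα, ← hZ0]; exact hZ t ht
    · rw [ha α (by rwa [Multiset.card_pos])]
      simp only [Pi.zero_apply, abs_zero]; positivity
  | succ r ih =>
    intro hr a θ D hDK hθ1 hθ ha hD hL hZ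
    have hD0 : 0 ≤ D := (abs_nonneg _).trans (hD 0 0 zero_le_one)
    have hμ0 : 0 ≤ μ := by positivity
    have h2r : (1 : ℝ) ≤ 2 ^ r := one_le_pow₀ one_le_two
    rw [pow_succ] at hθ
    have hθ0 : 0 ≤ θ := by nlinarith
    have hm : (m : ℝ) + 1 ≥ 1 := by linarith [(Nat.cast_nonneg m : (0 : ℝ) ≤ m)]
    have ham : ∀ α, m < Multiset.card α → a α = 0 := fun α hα => ha α (by omega)
    have hDK' : D ≤ K := (le_mul_of_one_le_right hD0 (one_le_pow₀ hm)).trans hDK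
    have hcoef (k : Fin d) (β : Multiset (Fin d)) (f : ℝ) (hβ : Multiset.card β ≤ m) (hf : 0 ≤ f) :
        (β.count k + 1 : ℝ) * f ≤ (m + 1) * f := by
      have : (β.count k : ℝ) ≤ m := by exact_mod_cast (Multiset.count_le_card k β).trans hβ
      gcongr
    have hθ' : ((θ - lam) / 2 - c + μ) / 2 ^ r = (θ + μ) / 2 ^ (r + 1) := by
      rw [pow_succ, hμ]; field_simp; ring
    have hIH (k : Fin d) : ∀ β, ∀ t ≤ 1, |derivFamily k a β t|
        ≤ (K : ℝ) ^ ((m + 1) * r) * ε ^ ((θ + μ) / 2 ^ (r + 1) - μ) := by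
      rw [← hθ']
      refine ih (by omega) (derivFamily k a) _ ((m + 1) * D) ?_ ?_ ?_
        (fun β hβ => derivFamily_eq_zero ha k β hβ) (fun β t ht => ?_) (fun β s hs t ht => ?_)
        (fun t ht => hw.abs_wienerPolynomial_derivFamily_le_rpow hK hε hε1 hc hlam hθ0
          (le_trans ?_ hB) hDK' ham hD hL hZ ht k)
      · calc _ = D * (m + 1) ^ (r + 1) := by ring
          _ ≤ _ := hDK
      · linarith
      · linarith
      · by_cases hβ : r < Multiset.card β
        · rw [derivFamily_eq_zero ha k β hβ]; simp only [Pi.zero_apply, abs_zero]; positivity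
        · rw [derivFamily, abs_mul, abs_of_nonneg (by positivity)]
          exact (hcoef k β _ (by omega) (abs_nonneg _)).trans
            (mul_le_mul_of_nonneg_left (hD _ t ht) (by positivity))
      · by_cases hβ : r < Multiset.card β
        · rw [derivFamily_eq_zero ha k β hβ]; simp only [Pi.zero_apply, sub_self, abs_zero]
          positivity
        · rw [derivFamily, derivFamily, ← mul_sub, abs_mul, abs_of_nonneg (by positivity)]
          refine (hcoef k β _ (by omega) (abs_nonneg _)).trans
            ((mul_le_mul_of_nonneg_left (hL _ s hs t ht) (by positivity)).trans (le_of_eq ?_))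
          ring
      · gcongr 2 * ?_
        exact Real.rpow_le_rpow_of_exponent_ge hε hε1 (by linarith)
    set ψ := (θ + μ) / 2 ^ (r + 1) - μ
    have hψ : ψ ≤ θ := by
      have : (θ + μ) / 2 ^ (r + 1) ≤ θ + μ :=
        div_le_self (by linarith) (one_le_pow₀ one_le_two)
      linarith
    -- Every nonconstant coefficient appears in some partial derivative with a factor at least one.
    have hcons : ∀ α ≠ 0, ∀ t ≤ 1, |a α t| ≤ (K : ℝ) ^ ((m + 1) * r) * ε ^ ψ := by
      intro α hα t ht
      obtain ⟨k, hk⟩ := Multiset.exists_mem_of_ne_zero hα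
      obtain ⟨β, rfl⟩ := Multiset.exists_cons_of_mem hk
      refine le_trans ?_ (hIH k β t ht)
      rw [derivFamily, abs_mul, abs_of_nonneg (by positivity : (0 : ℝ) ≤ β.count k + 1)]
      exact le_mul_of_one_le_left (abs_nonneg _) (by linarith [(Nat.cast_nonneg (β.count k) : (0 : ℝ) ≤ _)])
    have hεψ : 0 < ε ^ ψ := Real.rpow_pos_of_pos hε ψ
    intro α t ht
    -- The constant coefficient is invisible to derivatives; it is recovered as `Z` minus the other
    -- terms. Bounding the monomials costs `K ^ m`, and the constants one more `K`: hence `K ^ (m +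
    -- 1)` per degree.
    by_cases hα : α = 0
    · subst hα
      have hZt := wienerPolynomial_eq_sum w ham t
      rw [← Finset.add_sum_erase _ _ (by simp : (0 : Multiset (Fin d)) ∈ indices d m),
        monomial_zero, mul_one] at hZt
      have hsum : |∑ α ∈ (indices d m).erase 0, a α t * monomial (fun k => w k t) α|
          ≤ S * ((K : ℝ) ^ ((m + 1) * r) * ε ^ ψ * (16 * K) ^ m) := by
        refine (Finset.abs_sum_le_sum_abs _ _).trans ((Finset.sum_le_card_nsmul _ _
          ((K : ℝ) ^ ((m + 1) * r) * ε ^ ψ * (16 * K) ^ m) fun β hβ => ?_).trans ?_)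
        · rw [abs_mul]
          refine mul_le_mul (hcons β (Finset.ne_of_mem_erase hβ) t ht)
            ((abs_monomial_le (hw.abs_le (by exact_mod_cast hK1) ht) β).trans
              (pow_le_pow_right₀ (by linarith) ?_)) (abs_nonneg _) (by positivity)
          exact mem_indices.1 (Finset.mem_of_mem_erase hβ)
        · rw [nsmul_eq_mul]
          gcongr
          exact Finset.card_erase_le
      have h1 : a 0 t = wienerPolynomial w a t
          - ∑ α ∈ (indices d m).erase 0, a α t * monomial (fun k => w k t) α := by linarith
      rw [h1]
      have h2 := norm_sub_le (wienerPolynomial w a t)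
        (∑ α ∈ (indices d m).erase 0, a α t * monomial (fun k => w k t) α)
      simp only [Real.norm_eq_abs] at h2
      have h3 : ε ^ θ ≤ ε ^ ψ := Real.rpow_le_rpow_of_exponent_ge hε hε1 hψ
      have h4 : (1 : ℝ) ≤ (K : ℝ) ^ ((m + 1) * r + m) := one_le_pow₀ hK1
      calc _ ≤ ε ^ ψ + S * ((K : ℝ) ^ ((m + 1) * r) * ε ^ ψ * (16 * K) ^ m) := by
            linarith [hZ t ht]
        _ = ε ^ ψ * (1 + S * 16 ^ m * (K : ℝ) ^ ((m + 1) * r + m)) := by ring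
        _ ≤ ε ^ ψ * ((K : ℝ) ^ ((m + 1) * r + m) + S * 16 ^ m * (K : ℝ) ^ ((m + 1) * r + m)) := by
          gcongr
        _ = ε ^ ψ * ((1 + S * 16 ^ m) * (K : ℝ) ^ ((m + 1) * r + m)) := by ring
        _ ≤ ε ^ ψ * (K * (K : ℝ) ^ ((m + 1) * r + m)) := by gcongr
        _ = _ := by ring
    · refine (hcons α hα t ht).trans ?_
      gcongr ?_ * _
      exact pow_le_pow_right₀ hK1 (by nlinarith)

/-! ### Normalization and the dichotomy for regular paths -/

theorem iSup_supNorm_le_of_degree_zero (w : Fin d → ℝ≥0 → ℝ)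
    {a : Multiset (Fin d) → ℝ≥0 → ℝ} (ha : ∀ α, 0 < Multiset.card α → a α = 0) :
    ⨆ α, supNorm (a α) ≤ supNorm (wienerPolynomial w a) := by
  refine iSup_le fun α => ?_
  by_cases hα : α = 0
  · subst hα
    rw [← funext (wienerPolynomial_eq_of_degree_zero w ha)]
  · rw [ha α (by rwa [Multiset.card_pos])]
    simp [supNorm]

theorem wienerPolynomial_div {m : ℕ} (w : Fin d → ℝ≥0 → ℝ) {a : Multiset (Fin d) → ℝ≥0 → ℝ}
    (ha : ∀ α, m < Multiset.card α → a α = 0) (M : ℝ) (t : ℝ≥0) :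
    wienerPolynomial w (fun α t => a α t / M) t = wienerPolynomial w a t / M := by
  rw [wienerPolynomial_eq_sum w ha, wienerPolynomial_eq_sum w (m := m), Finset.sum_div]
  · exact Finset.sum_congr rfl fun α _ => by ring
  · intro α hα
    ext t
    simp [ha α hα]

theorem abs_sub_le_of_lipNorm_le {f : ℝ≥0 → ℝ} {L : ℝ} (hL : 0 ≤ L)
    (hf : lipNorm f ≤ ENNReal.ofReal L) {s t : ℝ≥0} (hs : s ≤ 1) (ht : t ≤ 1) :
    |f s - f t| ≤ L * dist s t := by
  have h := (lipNorm_le_iff.1 hf).dist_le_mul s ⟨zero_le, hs⟩ t ⟨zero_le, ht⟩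
  rwa [Real.dist_eq, Real.coe_toNNReal _ hL] at h

/-- Dividing by the supremum of the coefficients requires it to be finite, which follows from the
Lipschitz bound because only finitely many coefficients are nonzero. -/
theorem iSup_supNorm_ne_top {m : ℕ} {a : Multiset (Fin d) → ℝ≥0 → ℝ}
    (ha : ∀ α, m < Multiset.card α → a α = 0) {L : ℝ} (hL : 0 ≤ L)
    (hlip : ∀ α, lipNorm (a α) ≤ ENNReal.ofReal L) : ⨆ α, supNorm (a α) ≠ ∞ := by
  have h0 : 0 ≤ ∑ α ∈ indices d m, |a α 0| := Finset.sum_nonneg fun _ _ => abs_nonneg _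
  refine ne_top_of_le_ne_top (ENNReal.ofReal_ne_top (r := ∑ α ∈ indices d m, |a α 0| + L))
    (iSup_le fun α => (supNorm_le_iff (by positivity)).2 fun t ht => ?_)
  by_cases hα : m < Multiset.card α
  · rw [ha α hα]; simp only [Pi.zero_apply, abs_zero]; positivity
  · have h1 : |a α 0| ≤ ∑ α ∈ indices d m, |a α 0| :=
      Finset.single_le_sum (f := fun α => |a α 0|) (fun _ _ => abs_nonneg _) (by simpa using hα)
    have h2 := abs_sub_le_of_lipNorm_le hL (hlip α) ht zero_le_one
    have h3 : L * dist t 0 ≤ L := by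
      refine mul_le_of_le_one_right hL ?_
      rw [NNReal.dist_eq]
      simpa using ht
    have h4 := abs_sub_abs_le_abs_sub (a α t) (a α 0)
    linarith

/-- The exponent that relates the regularity parameter of a path to the size `ε` of a Wiener
polynomial of degree `m`. -/
def scaleExponent (m : ℕ) : ℕ := 54 * 2 ^ m * (m + 5) ^ 2

/-- The regularity parameter required from a path at the size `ε`. -/
noncomputable def scale (m : ℕ) (ε : ℝ) : ℕ := ⌈ε ^ (-(1 / (scaleExponent m : ℝ)))⌉₊

theorem scaleExponent_pos (m : ℕ) : 0 < scaleExponent m := by unfold scaleExponent; positivity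

theorem le_scale (m : ℕ) (ε : ℝ) : ε ^ (-(1 / (scaleExponent m : ℝ))) ≤ scale m ε :=
  Nat.le_ceil _

theorem rpow_neg_le_scale_pow {m : ℕ} {ε : ℝ} (hε : 0 < ε) (k : ℕ) :
    ε ^ (-(k : ℝ)) ≤ (scale m ε : ℝ) ^ (k * scaleExponent m) := by
  have hE : (scaleExponent m : ℝ) ≠ 0 := by exact_mod_cast (scaleExponent_pos m).ne'
  calc ε ^ (-(k : ℝ)) = (ε ^ (-(1 / (scaleExponent m : ℝ)))) ^ (k * scaleExponent m) := by
        rw [← Real.rpow_natCast, ← Real.rpow_mul hε.le]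
        congr 1; push_cast; field_simp
    _ ≤ _ := by gcongr; exact le_scale m ε

/-- Rounding up at most squares `x = ε ^ (-1 / scaleExponent m)` once `scale m ε ≥ 4`; this doubling
explains `54 = 2 * 27`. The power `(m + 5) ^ 2` dominates every power of `K` used in the induction.
-/
theorem scale_pow_le {m : ℕ} {ε : ℝ} (hε : 0 < ε) (hε1 : ε ≤ 1) (hK : 4 ≤ scale m ε) :
    (scale m ε : ℝ) ^ ((m + 5) ^ 2) ≤ ε ^ (-(1 / (27 * 2 ^ m) : ℝ)) := by
  set x := ε ^ (-(1 / (scaleExponent m : ℝ))) with hx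
  have hE : (0 : ℝ) < scaleExponent m := by exact_mod_cast scaleExponent_pos m
  have hx0 : 0 < x := Real.rpow_pos_of_pos hε _
  have hx1 : 1 ≤ x := Real.one_le_rpow_of_pos_of_le_one_of_nonpos hε hε1 (by
    rw [neg_nonpos]; positivity)
  have hK' : (4 : ℝ) ≤ scale m ε := by exact_mod_cast hK
  have h1 : (scale m ε : ℝ) < x + 1 := Nat.ceil_lt_add_one hx0.le
  have h2 : (scale m ε : ℝ) ≤ x ^ 2 := by nlinarith
  calc (scale m ε : ℝ) ^ ((m + 5) ^ 2) ≤ (x ^ 2) ^ ((m + 5) ^ 2) := by gcongr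
    _ = _ := by
      rw [← pow_mul, hx, ← Real.rpow_natCast, ← Real.rpow_mul hε.le]
      congr 1
      have : (scaleExponent m : ℝ) = 54 * 2 ^ m * (m + 5) ^ 2 := by simp [scaleExponent]
      rw [this]; push_cast; field_simp; ring

/-- Normalization turns the Lipschitz exponent `κ / 3` into `4 * κ / 3`, and `m` halvings weigh it
by `2 ^ m`. Base `3` keeps this below one, with equality at `m = 1`; the bound fails for `m = 0`,
which is why that degree is treated separately. -/
theorem four_mul_two_pow_le {m : ℕ} (hm : m ≠ 0) :
    (2 : ℝ) ^ m * (4 * (3 : ℝ) ^ (-(m : ℤ)) / 3) ≤ 8 / 9 := by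
  obtain ⟨n, rfl⟩ := Nat.exists_eq_succ_of_ne_zero hm
  have h : ((2 : ℝ) / 3) ^ n ≤ 1 := pow_le_one₀ (by norm_num) (by norm_num)
  rw [zpow_neg, zpow_natCast, Nat.succ_eq_add_one]
  calc (2 : ℝ) ^ (n + 1) * (4 * (3 ^ (n + 1))⁻¹ / 3) = 8 / 9 * (2 / 3) ^ n := by
        rw [div_pow]; field_simp; ring
    _ ≤ _ := by linarith

/-- If both alternatives fail, then `M > ε ^ κ`, so `a / M` is bounded by one, has Lipschitz
constants at most `ε ^ (-4 * κ / 3)`, and its polynomial is at most `ε ^ (1 - κ)`. The induction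
then bounds every `a α` by `M / 2`. -/
theorem IsRegular.iSup_supNorm_le_or {m : ℕ} {w : Fin d → ℝ≥0 → ℝ} {ε : ℝ} (hε : 0 < ε)
    (hε1 : ε ≤ 1) (hw : IsRegular (scale m ε) (2 * scaleExponent m + 1) w)
    (hK : threshold d m + 4 ≤ scale m ε) {a : Multiset (Fin d) → ℝ≥0 → ℝ}
    (ha : ∀ α, m < Multiset.card α → a α = 0)
    (hZ : supNorm (wienerPolynomial w a) ≤ ENNReal.ofReal ε) :
    ⨆ α, supNorm (a α) ≤ ENNReal.ofReal (ε ^ ((3 : ℝ) ^ (-(m : ℤ)))) ∨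
      ENNReal.ofReal (ε ^ (-((3 : ℝ) ^ (-((m : ℤ) + 1))))) ≤ ⨆ α, lipNorm (a α) := by
  rcases eq_or_ne m 0 with rfl | hm
  · left
    refine (iSup_supNorm_le_of_degree_zero w ha).trans (hZ.trans (le_of_eq ?_))
    simp
  by_contra! hcon
  obtain ⟨hM, hL⟩ := hcon
  set κ := (3 : ℝ) ^ (-(m : ℤ)) with hκ
  have hκ3 : (3 : ℝ) ^ (-((m : ℤ) + 1)) = κ / 3 := by
    rw [neg_add, zpow_add₀ (by norm_num)]; simp [hκ, div_eq_mul_inv]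
  rw [hκ3] at hL
  have hκ0 : 0 < κ := by positivity
  have hκm := four_mul_two_pow_le hm
  rw [← hκ] at hκm
  have h2m : (2 : ℝ) ≤ 2 ^ m := by
    calc (2 : ℝ) = 2 ^ 1 := by norm_num
      _ ≤ _ := pow_le_pow_right₀ one_le_two (by omega)
  set L := ε ^ (-(κ / 3)) with hLdef
  have hL0 : 0 ≤ L := by positivity
  have hlip : ∀ α, lipNorm (a α) ≤ ENNReal.ofReal L := fun α => (le_iSup _ α).trans hL.le
  set s := ⨆ α, supNorm (a α) with hs
  have hsT : s ≠ ∞ := iSup_supNorm_ne_top ha hL0 hlip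
  set M := s.toReal with hMdef
  have hsM : s = ENNReal.ofReal M := (ENNReal.ofReal_toReal hsT).symm
  have hεκ : 0 < ε ^ κ := Real.rpow_pos_of_pos hε _
  have hMε : ε ^ κ < M := by
    rw [hsM] at hM
    exact (ENNReal.ofReal_lt_ofReal_iff_of_nonneg hεκ.le).1 hM
  have hM0 : 0 < M := hεκ.trans hMε
  have haM : ∀ α, ∀ t ≤ 1, |a α t| ≤ M := fun α =>
    (supNorm_le_iff hM0.le).1 (by rw [← hsM]; exact le_iSup (fun α => supNorm (a α)) α)
  set c : ℝ := 1 / (27 * 2 ^ m) with hc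
  have hc0 : 0 < c := by positivity
  have hcm : 2 ^ m * c = 1 / 27 := by rw [hc]; field_simp
  have hKc := scale_pow_le hε hε1 ((Nat.le_add_left _ _).trans hK)
  set K := scale m ε with hKdef
  have hK4 : (4 : ℝ) ≤ K := by exact_mod_cast (Nat.le_add_left _ _).trans hK
  have hmain := hw.abs_coeff_le (m := m) ((Nat.le_add_right _ _).trans hK) (c := c)
    (lam := 4 * κ / 3) hε hε1 hc0.le ((pow_le_pow_right₀ (by linarith) (by nlinarith)).trans hKc)
    (by positivity) (by nlinarith) ?_ m le_rfl (fun α t => a α t / M) (1 - κ) 1 ?_ (by linarith) ?_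
    ?_ ?_ ?_ ?_
  -- The budget is `2 ^ m * (4 * κ / 3 + 3 * c) ≤ 8 / 9 + 3 / 27 = 1`, which fixes the choice of
  -- `c`.
  · have hψ : c ≤ (1 - κ + (4 * κ / 3 + 2 * c)) / 2 ^ m - (4 * κ / 3 + 2 * c) := by
      rw [le_sub_iff_add_le, le_div_iff₀ (by positivity)]
      nlinarith
    have hhalf : s ≤ ENNReal.ofReal (M / 2) := by
      refine iSup_le fun α => (supNorm_le_iff (by positivity)).2 fun t ht => ?_
      have h1 := hmain α t ht
      rw [abs_div, abs_of_pos hM0, div_le_iff₀ hM0] at h1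
      have h2 : (K : ℝ) ^ ((m + 1) * m)
          * ε ^ ((1 - κ + (4 * κ / 3 + 2 * c)) / 2 ^ m - (4 * κ / 3 + 2 * c)) ≤ 1 / 2 := by
        have h3 : (K : ℝ) ^ ((m + 1) * m) * ε ^ c * 2 ≤ 1 := by
          calc (K : ℝ) ^ ((m + 1) * m) * ε ^ c * 2 ≤ (K : ℝ) ^ ((m + 1) * m) * ε ^ c * K := by
                gcongr; linarith
            _ = (K : ℝ) ^ ((m + 1) * m + 1) * ε ^ c := by ring
            _ ≤ ε ^ (-c) * ε ^ c := by
              gcongr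
              exact (pow_le_pow_right₀ (by linarith) (by nlinarith)).trans hKc
            _ = 1 := by rw [← Real.rpow_add hε]; simp
        have h4 := Real.rpow_le_rpow_of_exponent_ge hε hε1 hψ
        have h5 := mul_le_mul_of_nonneg_left h4 (by positivity : (0 : ℝ) ≤ (K : ℝ) ^ ((m + 1) * m))
        linarith
      nlinarith
    rw [hsM, ENNReal.ofReal_le_ofReal_iff (by positivity)] at hhalf
    linarith
  · have h1 := rpow_neg_le_scale_pow (m := m) hε 2
    push_cast at h1
    rw [pow_succ, ← hKdef] at *
    have h2 : 0 < ε ^ (-(2 : ℝ)) := Real.rpow_pos_of_pos hε _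
    nlinarith
  · have h1 : (m + 1) ^ m ≤ K := (Nat.le_add_left _ _).trans ((Nat.le_add_right _ _).trans hK)
    rw [one_mul]; exact_mod_cast h1
  · nlinarith
  · intro α hα
    ext t
    simp [ha α hα]
  · intro α t ht
    rw [abs_div, abs_of_pos hM0, div_le_one hM0]
    exact haM α t ht
  · intro α s hs t ht
    rw [← sub_div, abs_div, abs_of_pos hM0, one_mul, div_le_iff₀ hM0]
    refine (abs_sub_le_of_lipNorm_le hL0 (hlip α) hs ht).trans ?_
    have h1 : L = ε ^ (-(4 * κ / 3)) * ε ^ κ := by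
      rw [hLdef, ← Real.rpow_add hε]; congr 1; ring
    rw [h1, mul_right_comm]
    gcongr
  · intro t ht
    rw [wienerPolynomial_div w ha, abs_div, abs_of_pos hM0, div_le_iff₀ hM0]
    refine ((supNorm_le_iff hε.le).1 hZ t ht).trans ?_
    calc ε = ε ^ (1 - κ) * ε ^ κ := by rw [← Real.rpow_add hε]; simp
      _ ≤ _ := by gcongr

/-! ### Independent trials and Gaussian estimates -/

section Independence

variable {Ω κ ι : Type*} [MeasurableSpace Ω] {P : Measure Ω} [Fintype κ] {X : κ → ι → Ω → ℝ}
  {s : κ → Set ℝ} {r : ℝ≥0∞}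

/-- Independence across `k` of the sequences and across `i` within each sequence gives joint
independence in `(k, i)`. Hence the success events, indexed by `i`, are independent, each of
probability at least `r ^ Fintype.card κ`. -/
theorem measure_forall_exists_notMem_le_of_measurable (hX : ∀ k i, Measurable (X k i))
    (h1 : iIndepFun (fun k ω i => X k i ω) P) (h2 : ∀ k, iIndepFun (X k) P)
    (hs : ∀ k, MeasurableSet (s k)) (hr : ∀ k i, r ≤ P (X k i ⁻¹' s k)) (t : Finset ι) :
    P {ω | ∀ i ∈ t, ∃ k, X k i ω ∉ s k} ≤ (1 - r ^ Fintype.card κ) ^ t.card := by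
  have hP : IsProbabilityMeasure P := h1.isProbabilityMeasure
  have hind := iIndepFun_iff_measure_inter_preimage_eq_mul.1 (iIndepFun_uncurry' hX h1 h2)
  set G : ι → Set Ω := fun i => {ω | ∀ k, X k i ω ∈ s k} with hG
  have hGm (i : ι) : MeasurableSet (G i) := by
    simp only [hG, ofPred_forall]
    exact MeasurableSet.iInter fun k => hX k i (hs k)
  have hprod (u : Finset ι) : P (⋂ i ∈ u, G i) = ∏ i ∈ u, ∏ k, P (X k i ⁻¹' s k) := by
    have h := hind (Finset.univ ×ˢ u) (sets := fun p => s p.1) fun p _ => hs p.1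
    rw [Finset.prod_product_right] at h
    rw [← h]
    congr 1
    ext ω
    simp only [hG, mem_iInter, mem_ofPred_eq, Finset.mem_product, Finset.mem_univ, true_and,
      mem_preimage, Prod.forall]
    exact ⟨fun h k i hi => h i hi k, fun h i hi k => h k i hi⟩
  have hGP (i : ι) : P (G i) = ∏ k, P (X k i ⁻¹' s k) := by simpa using hprod {i}
  have hGi : iIndepSet G P := by
    rw [iIndepSet_iff_meas_biInter hGm]
    intro u
    rw [hprod]
    exact Finset.prod_congr rfl fun i _ => (hGP i).symm
  have hcompl := (iIndepSet_iff G P).1 hGi t (f := fun i => (G i)ᶜ)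
    fun i _ => (MeasurableSpace.measurableSet_generateFrom (by simp)).compl
  have hset : {ω | ∀ i ∈ t, ∃ k, X k i ω ∉ s k} = ⋂ i ∈ t, (G i)ᶜ := by
    ext ω; simp [hG]
  rw [hset, hcompl, ← Finset.prod_const]
  refine Finset.prod_le_prod' fun i _ => ?_
  rw [prob_compl_eq_one_sub (hGm i), hGP]
  gcongr
  rw [← Finset.card_univ, ← Finset.prod_const]
  exact Finset.prod_le_prod' fun k _ => hr k i

/-- Among independent trials with independent coordinates, the probability that none is
successful decays geometrically. -/
theorem measure_forall_exists_notMem_le [Countable ι] (hX : ∀ k i, AEMeasurable (X k i) P)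
    (h1 : iIndepFun (fun k ω i => X k i ω) P) (h2 : ∀ k, iIndepFun (X k) P)
    (hs : ∀ k, MeasurableSet (s k)) (hr : ∀ k i, r ≤ P (X k i ⁻¹' s k)) (t : Finset ι) :
    P {ω | ∀ i ∈ t, ∃ k, X k i ω ∉ s k} ≤ (1 - r ^ Fintype.card κ) ^ t.card := by
  have hae (k : κ) (i : ι) := (hX k i).ae_eq_mk
  have hall : ∀ᵐ ω ∂P, ∀ k i, X k i ω = (hX k i).mk _ ω := by
    rw [ae_all_iff]; intro k; rw [ae_all_iff]; exact hae k
  refine le_trans (measure_mono_ae ?_) (measure_forall_exists_notMem_le_of_measurable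
    (X := fun k i => (hX k i).mk _) (s := s) (r := r) (fun k i => (hX k i).measurable_mk)
    (h1.congr fun k => ?_) (fun k => (h2 k).congr (hae k)) hs (fun k i => ?_) t)
  · filter_upwards [hall] with ω hω h i hi
    obtain ⟨k, hk⟩ := h i hi
    exact ⟨k, by rwa [← hω]⟩
  · filter_upwards [hall] with ω hω
    exact funext (hω k)
  · refine (hr k i).trans (measure_mono_ae ?_)
    filter_upwards [hae k i] with ω hω h
    change (hX k i).mk _ ω ∈ s k
    rw [← hω]; exact h

end Independence

theorem gaussianReal_pos_of_Ioo_subset {s : Set ℝ} {x y : ℝ} (hxy : x < y) (h : Ioo x y ⊆ s) :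
    0 < gaussianReal 0 1 s := by
  refine pos_iff_ne_zero.2 fun h0 => ?_
  have h1 := measure_mono_null h (gaussianReal_absolutelyContinuous' 0 one_ne_zero h0)
  rw [Real.volume_Ioo, ENNReal.ofReal_eq_zero] at h1
  linarith

/-- The moments of the standard Gaussian measure. -/
noncomputable def gaussianMoment (N : ℕ) : ℝ≥0∞ := ∫⁻ x, ‖x‖ₑ ^ N ∂gaussianReal 0 1

theorem gaussianMoment_ne_top (N : ℕ) : gaussianMoment N ≠ ∞ := by
  rcases eq_or_ne N 0 with rfl | hN
  · simp [gaussianMoment]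
  · have h := memLp_id_gaussianReal (μ := 0) (v := 1) (N : ℝ≥0)
    have h2 := lintegral_rpow_enorm_lt_top_of_eLpNorm_lt_top (by simpa using hN)
      (by simp) h.eLpNorm_lt_top
    simpa [gaussianMoment] using h2.ne

theorem gaussianReal_abs_gt_le (N : ℕ) {x : ℝ} (hx : 0 < x) :
    gaussianReal 0 1 {y | x < |y|} ≤ gaussianMoment N / ENNReal.ofReal (x ^ N) := by
  have h := meas_ge_le_lintegral_div (μ := gaussianReal 0 1) (f := fun y : ℝ => ‖y‖ₑ ^ N)
    (by fun_prop) (ε := ENNReal.ofReal (x ^ N)) (by simpa using pow_pos hx N) (by simp)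
  refine (measure_mono fun y hy => ?_).trans h
  simp only [mem_ofPred_eq] at hy ⊢
  rw [ENNReal.ofReal_pow hx.le, Real.enorm_eq_ofReal_abs]
  gcongr

section Brownian

variable {Ω : Type*} [MeasurableSpace Ω] {P : Measure Ω} {B : ℝ≥0 → Ω → ℝ}

/-- Rescaled increments of Brownian motion are standard Gaussian. -/
theorem hasLaw_sqrt_mul_increment (hB : IsPreBrownianReal B P) {s t : ℝ≥0} (hst : s ≤ t) {c : ℝ}
    (hc : 0 ≤ c) (hcst : c * (t - s : ℝ) = 1) :
    HasLaw (fun ω => √c * (B t ω - B s ω)) (gaussianReal 0 1) P := by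
  have h := gaussianReal_const_mul (hB.hasLaw_sub t s) √c
  convert h using 1
  · rfl
  rw [mul_zero]
  congr 1
  ext
  push_cast
  have h1 : (s : ℝ) ≤ t := by exact_mod_cast hst
  have h2 : dist (t : ℝ) s = t - s := by rw [Real.dist_eq, abs_of_nonneg (by linarith)]
  rw [Real.sq_sqrt hc]
  exact hcst.symm.trans (congrArg (c * ·) h2.symm)

end Brownian

theorem dyadic_le_succ (n j : ℕ) : dyadic n j ≤ dyadic n (j + 1) := by
  unfold dyadic; gcongr; omega

/-! ### Probability of large oscillations -/

section Oscillation

variable {Ω : Type*} [MeasurableSpace Ω] {P : Measure Ω}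

/-- After rescaling, the level is `K * (√2 * (7 / 8)) ^ r`, which grows in `r` because `7 / 8 > 1 /
√2`. Eight moments already turn this growth into the decay `4⁻¹ ^ r`, enough to beat the number of
intervals. -/
theorem measure_increment_gt_le {B : ℝ≥0 → Ω → ℝ} (hB : IsPreBrownianReal B P) {K N : ℕ}
    (hK : 1 ≤ K) (hN : 8 ≤ N) (n r j : ℕ) :
    P {ω | K / √(2 ^ n) * (7 / 8) ^ r
        < |B (dyadic (n + r) (j + 1)) ω - B (dyadic (n + r) j) ω|}
      ≤ gaussianMoment N / K ^ N * 4⁻¹ ^ r := by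
  have hK1 : (1 : ℝ) ≤ K := by exact_mod_cast hK
  have hlaw := hasLaw_sqrt_mul_increment hB (dyadic_le_succ (n + r) j) (c := 2 ^ (n + r))
    (by positivity) (by simp only [dyadic]; push_cast; field_simp; ring)
  set x : ℝ := K * (√2 * (7 / 8)) ^ r with hx
  have hx0 : 0 < x := by positivity
  have hxe : √(2 ^ (n + r)) * (K / √(2 ^ n) * (7 / 8) ^ r) = x := by
    have h2 : √((2 : ℝ) ^ r) = √2 ^ r := by
      rw [Real.sqrt_eq_iff_mul_self_eq (by positivity) (by positivity), ← mul_pow,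
        Real.mul_self_sqrt zero_le_two]
    rw [hx, pow_add, Real.sqrt_mul (by positivity), mul_pow, h2]
    have : √((2 : ℝ) ^ n) ≠ 0 := by positivity
    field_simp
  have h1 : P {ω | K / √(2 ^ n) * (7 / 8) ^ r
        < |B (dyadic (n + r) (j + 1)) ω - B (dyadic (n + r) j) ω|}
      = gaussianReal 0 1 {y | x < |y|} := by
    rw [← hlaw.map_eq, Measure.map_apply_of_aemeasurable hlaw.aemeasurable
      (measurableSet_lt measurable_const (by fun_prop))]
    congr 1
    ext ω
    simp only [mem_ofPred_eq, mem_preimage]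
    rw [abs_mul, abs_of_nonneg (Real.sqrt_nonneg _), ← hxe]
    exact (mul_lt_mul_iff_right₀ (by positivity)).symm
  rw [h1]
  refine (gaussianReal_abs_gt_le N hx0).trans ?_
  have h4 : (4 : ℝ) ^ r ≤ ((√2 * (7 / 8)) ^ r) ^ N := by
    have h2 : (4 : ℝ) ≤ (√2 * (7 / 8)) ^ 8 := by
      have h3 : (√2 * (7 / 8)) ^ 8 = (√2 ^ 2) ^ 4 * (7 / 8) ^ 8 := by ring
      rw [h3, Real.sq_sqrt (by norm_num)]; norm_num
    have h5 : (1 : ℝ) ≤ √2 * (7 / 8) := by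
      by_contra! h
      have := pow_lt_one₀ (by positivity) h (by norm_num : (8 : ℕ) ≠ 0)
      linarith
    rw [pow_right_comm]
    gcongr
    exact h2.trans (pow_le_pow_right₀ h5 hN)
  have h6 : (K : ℝ≥0∞) ^ N * 4 ^ r ≤ ENNReal.ofReal (x ^ N) := by
    rw [hx, mul_pow]
    calc (K : ℝ≥0∞) ^ N * 4 ^ r = ENNReal.ofReal ((K : ℝ) ^ N * 4 ^ r) := by
          rw [ENNReal.ofReal_mul (by positivity), ENNReal.ofReal_pow (by positivity),
            ENNReal.ofReal_pow (by positivity)]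
          simp
      _ ≤ _ := by gcongr
  calc _ ≤ gaussianMoment N / (K ^ N * 4 ^ r) := by gcongr
    _ = _ := by
      rw [div_eq_mul_inv, div_eq_mul_inv, ENNReal.mul_inv (by simp) (by simp), ENNReal.inv_pow,
        mul_assoc]
      congr 2
      rw [ENNReal.inv_pow]

/-- The `2 ^ (n + r)` intervals at depth `r` contribute `2 ^ n * 2⁻¹ ^ r` in total; the geometric
series gives the factor `2`. -/
theorem measure_exists_osc_gt_le {W : Fin d → ℝ≥0 → Ω → ℝ}
    (hB : ∀ k, IsPreBrownianReal (W k) P) {K N : ℕ} (hK : 1 ≤ K) (hN : 8 ≤ N) (n : ℕ) :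
    P {ω | ∃ k r j, j < 2 ^ (n + r) ∧ K / √(2 ^ n) * (7 / 8) ^ r
        < |W k (dyadic (n + r) (j + 1)) ω - W k (dyadic (n + r) j) ω|}
      ≤ d * (2 ^ n * (2 * (gaussianMoment N / K ^ N))) := by
  set E : Fin d → ℕ → ℕ → Set Ω := fun k r j => {ω | K / √(2 ^ n) * (7 / 8) ^ r
        < |W k (dyadic (n + r) (j + 1)) ω - W k (dyadic (n + r) j) ω|} with hE
  set x := gaussianMoment N / K ^ N
  have hset : {ω | ∃ k r j, j < 2 ^ (n + r) ∧ K / √(2 ^ n) * (7 / 8) ^ r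
        < |W k (dyadic (n + r) (j + 1)) ω - W k (dyadic (n + r) j) ω|}
      = ⋃ k ∈ Finset.univ, ⋃ r, ⋃ j ∈ Finset.range (2 ^ (n + r)), E k r j := by
    ext ω; simp [hE]
  have hr (k : Fin d) (r : ℕ) : P (⋃ j ∈ Finset.range (2 ^ (n + r)), E k r j)
      ≤ 2 ^ n * x * 2⁻¹ ^ r := by
    refine (measure_biUnion_finset_le _ _).trans ((Finset.sum_le_card_nsmul _ _ _
      fun j _ => measure_increment_gt_le (hB k) hK hN n r j).trans (le_of_eq ?_))
    rw [Finset.card_range, nsmul_eq_mul]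
    push_cast
    have h42 : (4 : ℝ≥0∞)⁻¹ = 2⁻¹ * 2⁻¹ := by
      rw [← ENNReal.mul_inv (by simp) (by simp)]; norm_num
    have h22 : (2 : ℝ≥0∞) ^ r * 2⁻¹ ^ r = 1 := by
      rw [← mul_pow, ENNReal.mul_inv_cancel (by simp) (by simp), one_pow]
    calc (2 : ℝ≥0∞) ^ (n + r) * (x * 4⁻¹ ^ r)
        = 2 ^ n * x * 2⁻¹ ^ r * (2 ^ r * 2⁻¹ ^ r) := by rw [h42, mul_pow]; ring
      _ = _ := by rw [h22, mul_one]
  have hk (k : Fin d) : P (⋃ r, ⋃ j ∈ Finset.range (2 ^ (n + r)), E k r j)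
      ≤ 2 ^ n * (2 * x) := by
    refine (measure_iUnion_le _).trans ((ENNReal.tsum_le_tsum (hr k)).trans (le_of_eq ?_))
    rw [ENNReal.tsum_mul_left, ENNReal.tsum_geometric, ENNReal.one_sub_inv_two, inv_inv]
    ring
  rw [hset]
  refine (measure_biUnion_finset_le _ _).trans
    ((Finset.sum_le_card_nsmul _ _ _ fun k _ => hk k).trans (le_of_eq ?_))
  simp

end Oscillation

/-! ### Probability of degenerate increments -/

/-- A lower bound for the probability that a standard Gaussian variable has a prescribed order of
magnitude. -/
noncomputable def gaussianChance (d : ℕ) : ℝ≥0∞ :=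
  min (gaussianReal 0 1 {x | 1 ≤ |x|}) (gaussianReal 0 1 {x | 2 * d * |x| ≤ 1})

theorem gaussianChance_pos (d : ℕ) : 0 < gaussianChance d := by
  refine lt_min (gaussianReal_pos_of_Ioo_subset (one_lt_two) fun x hx => ?_)
    (gaussianReal_pos_of_Ioo_subset (x := 0) (y := 1 / (2 * d + 1)) (by positivity) fun x hx => ?_)
  · exact hx.1.le.trans (le_abs_self x)
  · have h := hx.2
    rw [lt_div_iff₀ (by positivity)] at h
    change 2 * d * |x| ≤ 1
    rw [abs_of_pos hx.1]
    nlinarith [hx.1]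

section Nondegeneracy

variable {Ω : Type*} [MeasurableSpace Ω] {P : Measure Ω} {W : Fin d → ℝ≥0 → Ω → ℝ}

/-- The `K` subintervals are independent trials. In each, the `d` rescaled increments are
independent standard Gaussians, so being large in direction `k` and small in all others has
probability at least `gaussianChance d ^ d`. -/
theorem measure_degenerate_le (hW : IsWienerFamily P W) {K : ℕ} (hK : 1 ≤ K) (n j : ℕ)
    (k : Fin d) :
    P {ω | ¬ ∃ i < K, 1 ≤ √(2 ^ n * K)
        * |W k ((j * K + i + 1 : ℕ) / (2 ^ n * K)) ω - W k ((j * K + i : ℕ) / (2 ^ n * K)) ω|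
      ∧ ∀ l, l ≠ k → 2 * d * (√(2 ^ n * K) *
        |W l ((j * K + i + 1 : ℕ) / (2 ^ n * K)) ω - W l ((j * K + i : ℕ) / (2 ^ n * K)) ω|) ≤ 1}
      ≤ (1 - gaussianChance d ^ d) ^ K := by
  have hK0 : (0 : ℝ) < K := by exact_mod_cast hK
  set τ : ℕ → ℝ≥0 := fun i => (j * K + i : ℕ) / (2 ^ n * K) with hτ
  have hτm : Monotone τ := fun a b hab => by simp only [hτ]; gcongr
  set X : Fin d → ℕ → Ω → ℝ := fun l i ω => √(2 ^ n * K) * (W l (τ (i + 1)) ω - W l (τ i) ω) with hX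
  set s : Fin d → Set ℝ := fun l => if l = k then {x | 1 ≤ |x|} else {x | 2 * d * |x| ≤ 1} with hs
  have hpre (l : Fin d) := (hW.isBrownian l).toIsPreBrownianReal
  have hlaw (l : Fin d) (i : ℕ) : HasLaw (X l i) (gaussianReal 0 1) P := by
    refine hasLaw_sqrt_mul_increment (hpre l) (hτm (Nat.le_succ i)) (by positivity) ?_
    simp only [hτ]; push_cast; field_simp; ring
  have hsm (l : Fin d) : MeasurableSet (s l) := by
    simp only [hs]
    split_ifs
    · exact measurableSet_le measurable_const (by fun_prop)
    · exact measurableSet_le (by fun_prop) measurable_const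
  have h := measure_forall_exists_notMem_le (X := X) (s := s) (r := gaussianChance d)
    (fun l i => (hlaw l i).aemeasurable) ?_ ?_ hsm ?_ (Finset.range K)
  · rw [Fintype.card_fin, Finset.card_range] at h
    refine le_trans (measure_mono ?_) h
    intro ω hω i hi
    by_contra! hcon
    refine hω ⟨i, Finset.mem_range.1 hi, ?_, fun l hl => ?_⟩
    · have h1 := hcon k
      simp only [hs, if_true, hX, mem_ofPred_eq, abs_mul, abs_of_nonneg (Real.sqrt_nonneg _)] at h1
      exact h1
    · have h1 := hcon l
      simp only [hs, if_neg hl, hX, mem_ofPred_eq, abs_mul, abs_of_nonneg (Real.sqrt_nonneg _)] at h1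
      exact h1
  · exact hW.indep.comp (fun _ w i => √(2 ^ n * K) * (w (τ (i + 1)) - w (τ i))) fun _ => by fun_prop
  · intro l
    exact ((hpre l).hasIndepIncrements.nat hτm).comp (fun _ x => √(2 ^ n * K) * x)
      fun _ => by fun_prop
  · intro l i
    rw [← Measure.map_apply_of_aemeasurable (hlaw l i).aemeasurable (hsm l), (hlaw l i).map_eq]
    simp only [hs]
    split_ifs
    · exact min_le_left _ _
    · exact min_le_right _ _

end Nondegeneracy

/-! ### Regularity with overwhelming probability -/

section Regularity

variable {Ω : Type*} [MeasurableSpace Ω] {P : Measure Ω} {W : Fin d → ℝ≥0 → Ω → ℝ}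

/-- Continuity and the start at zero hold almost surely; the remaining conditions are countably many
inequalities between values at fixed times. -/
theorem nullMeasurableSet_isRegular (hW : IsWienerFamily P W) (K B : ℕ) :
    NullMeasurableSet {ω | IsRegular K B (fun k t => W k t ω)} P := by
  have hm (k : Fin d) (t : ℝ≥0) : AEMeasurable (W k t) P :=
    (hW.isBrownian k).toIsPreBrownianReal.aemeasurable t
  have hset : {ω | IsRegular K B (fun k t => W k t ω)}
      = {ω | ∀ k, Continuous fun t => W k t ω} ∩ {ω | ∀ k, W k 0 ω = 0}
        ∩ {ω | ∀ n, 2 ^ n ≤ K ^ B → ∀ k r j, j < 2 ^ (n + r) →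
          |W k (dyadic (n + r) (j + 1)) ω - W k (dyadic (n + r) j) ω|
            ≤ K / √(2 ^ n) * (7 / 8) ^ r}
        ∩ {ω | ∀ n, 2 ^ n ≤ K ^ B → ∀ j < 2 ^ n, ∀ k, ∃ i < K, 1 ≤ √(2 ^ n * K)
            * |W k ((j * K + i + 1 : ℕ) / (2 ^ n * K)) ω - W k ((j * K + i : ℕ) / (2 ^ n * K)) ω|
          ∧ ∀ l, l ≠ k → 2 * d * (√(2 ^ n * K) * |W l ((j * K + i + 1 : ℕ) / (2 ^ n * K)) ω
            - W l ((j * K + i : ℕ) / (2 ^ n * K)) ω|) ≤ 1} := by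
    ext ω
    exact ⟨fun h => ⟨⟨⟨h.cont, h.zero⟩, h.osc⟩, h.nondeg⟩, fun h => ⟨h.1.1.1, h.1.1.2, h.1.2, h.2⟩⟩
  have hcont : ∀ᵐ ω ∂P, ω ∈ {ω | ∀ k, Continuous fun t => W k t ω} :=
    ae_all_iff.2 fun k => (hW.isBrownian k).cont
  have hzero : ∀ᵐ ω ∂P, ω ∈ {ω | ∀ k, W k 0 ω = 0} :=
    ae_all_iff.2 fun k => (hW.isBrownian k).toIsPreBrownianReal.eval_zero_ae_eq_zero
  rw [hset]
  refine NullMeasurableSet.inter (NullMeasurableSet.inter (NullMeasurableSet.inter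
    (NullMeasurableSet.of_null hcont).of_compl (NullMeasurableSet.of_null hzero).of_compl) ?_) ?_
  · simp only [ofPred_forall]
    refine .iInter fun n => .iInter fun _ => .iInter fun k => .iInter fun r => .iInter fun j =>
      .iInter fun _ => nullMeasurableSet_le ?_ aemeasurable_const
    exact ((hm k _).sub (hm k _)).abs
  · simp only [ofPred_forall, ofPred_exists, ofPred_and]
    refine .iInter fun n => .iInter fun _ => .iInter fun j => .iInter fun _ => .iInter fun k =>
      .iUnion fun i => .inter (.const _) (.inter (nullMeasurableSet_le aemeasurable_const ?_)
        (.iInter fun l => .iInter fun _ => nullMeasurableSet_le ?_ aemeasurable_const))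
    · exact ((hm k _).sub (hm k _)).abs.const_mul _
    · exact (((hm l _).sub (hm l _)).abs.const_mul _).const_mul _

/-- In the union bound one factor `K ^ B` counts the levels `n`, and the other bounds the `2 ^ n`
intervals at each level. -/
theorem measure_not_isRegular_le (hW : IsWienerFamily P W) {K N : ℕ} (hK : 1 ≤ K) (hN : 8 ≤ N)
    (B : ℕ) :
    P {ω | ¬ IsRegular K B (fun k t => W k t ω)} ≤ (d * K ^ (2 * B)
      * (2 * (gaussianMoment N / K ^ N) + (1 - gaussianChance d ^ d) ^ K) : ℝ≥0∞) := by
  set E1 : ℕ → Set Ω := fun n => {ω | ∃ k r j, j < 2 ^ (n + r) ∧ K / √(2 ^ n) * (7 / 8) ^ r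
        < |W k (dyadic (n + r) (j + 1)) ω - W k (dyadic (n + r) j) ω|} with hE1
  set E2 : ℕ → ℕ → Fin d → Set Ω := fun n j k => {ω | ¬ ∃ i < K, 1 ≤ √(2 ^ n * K)
        * |W k ((j * K + i + 1 : ℕ) / (2 ^ n * K)) ω - W k ((j * K + i : ℕ) / (2 ^ n * K)) ω|
      ∧ ∀ l, l ≠ k → 2 * d * (√(2 ^ n * K) *
        |W l ((j * K + i + 1 : ℕ) / (2 ^ n * K)) ω - W l ((j * K + i : ℕ) / (2 ^ n * K)) ω|) ≤ 1}
    with hE2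
  set x := gaussianMoment N / (K : ℝ≥0∞) ^ N
  set y := (1 - gaussianChance d ^ d) ^ K
  have hcont : P {ω | ¬ ∀ k, Continuous fun t => W k t ω} = 0 :=
    ae_iff.1 (ae_all_iff.2 fun k => (hW.isBrownian k).cont)
  have hzero : P {ω | ¬ ∀ k, W k 0 ω = 0} = 0 :=
    ae_iff.1 (ae_all_iff.2 fun k => (hW.isBrownian k).toIsPreBrownianReal.eval_zero_ae_eq_zero)
  set F := (Finset.range (K ^ B)).filter fun n => 2 ^ n ≤ K ^ B with hF
  have hsub : {ω | ¬ IsRegular K B (fun k t => W k t ω)}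
      ⊆ ({ω | ¬ ∀ k, Continuous fun t => W k t ω} ∪ {ω | ¬ ∀ k, W k 0 ω = 0})
        ∪ ⋃ n ∈ F, (E1 n ∪ ⋃ p ∈ Finset.range (2 ^ n) ×ˢ Finset.univ, E2 n p.1 p.2) := by
    intro ω hω
    by_contra hcon
    simp only [mem_union, not_or, mem_iUnion, not_exists] at hcon
    obtain ⟨⟨h1, h2⟩, h3⟩ := hcon
    have hmem {n : ℕ} (hn : 2 ^ n ≤ K ^ B) : n ∈ F :=
      Finset.mem_filter.2 ⟨Finset.mem_range.2 (Nat.lt_two_pow_self.trans_le hn), hn⟩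
    refine hω ⟨not_not.1 h1, not_not.1 h2, fun n hn k r j hj => ?_, fun n hn j hj k => ?_⟩
    · by_contra! h
      exact (h3 n (hmem hn)).1 ⟨k, r, j, hj, h⟩
    · exact not_not.1 ((h3 n (hmem hn)).2 (j, k) (by simpa using hj))
  have hterm : ∀ n ∈ F, P (E1 n ∪ ⋃ p ∈ Finset.range (2 ^ n) ×ˢ Finset.univ, E2 n p.1 p.2)
      ≤ K ^ B * (d * (2 * x + y)) := by
    intro n hn
    have hn' : (2 : ℝ≥0∞) ^ n ≤ K ^ B := by exact_mod_cast (Finset.mem_filter.1 hn).2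
    have h2 : P (⋃ p ∈ Finset.range (2 ^ n) ×ˢ Finset.univ, E2 n p.1 p.2) ≤ 2 ^ n * d * y := by
      refine (measure_biUnion_finset_le _ _).trans ((Finset.sum_le_card_nsmul _ _ _
        fun p _ => measure_degenerate_le hW hK n p.1 p.2).trans (le_of_eq ?_))
      simp [Finset.card_product]
      rfl
    calc _ ≤ _ := measure_union_le _ _
      _ ≤ d * (2 ^ n * (2 * x)) + 2 ^ n * d * y := add_le_add (measure_exists_osc_gt_le
          (fun k => (hW.isBrownian k).toIsPreBrownianReal) hK hN n) h2
      _ = 2 ^ n * (d * (2 * x + y)) := by ring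
      _ ≤ _ := by gcongr
  refine (measure_mono hsub).trans ((measure_union_le _ _).trans ?_)
  rw [measure_union_null hcont hzero, zero_add]
  refine (measure_biUnion_finset_le _ _).trans ((Finset.sum_le_card_nsmul _ _ _ hterm).trans ?_)
  have hcard : (F.card : ℝ≥0∞) ≤ K ^ B := by
    exact_mod_cast (Finset.card_filter_le _ _).trans (by simp)
  rw [nsmul_eq_mul]
  calc _ ≤ (K : ℝ≥0∞) ^ B * (K ^ B * (d * (2 * x + y))) := by gcongr
    _ = _ := by ring

end Regularity

/-- The moment order `2 * B + p + 8` absorbs `K ^ (2 * B)`, leaves `K ^ (-p)`, and stays above the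
eight moments needed for chaining. The trial term is geometric in `K`, so it beats every power. -/
theorem exists_irregularity_bound (d B p : ℕ) : ∃ C : ℝ, 0 ≤ C ∧ ∀ K : ℕ, 1 ≤ K →
    (d * K ^ (2 * B) * (2 * (gaussianMoment (2 * B + p + 8) / K ^ (2 * B + p + 8))
      + (1 - gaussianChance d ^ d) ^ K) : ℝ≥0∞) ≤ ENNReal.ofReal (C / K ^ p) := by
  set N := 2 * B + p + 8 with hN
  set g := (gaussianMoment N).toReal
  have hg : gaussianMoment N = ENNReal.ofReal g :=
    (ENNReal.ofReal_toReal (gaussianMoment_ne_top N)).symm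
  set ρ := (1 - gaussianChance d ^ d).toReal with hρdef
  have hρ1 : 1 - gaussianChance d ^ d < 1 :=
    ENNReal.sub_lt_self ENNReal.one_ne_top one_ne_zero (pow_ne_zero d (gaussianChance_pos d).ne')
  have hρ : 1 - gaussianChance d ^ d = ENNReal.ofReal ρ :=
    (ENNReal.ofReal_toReal (hρ1.trans ENNReal.one_lt_top).ne).symm
  have hρ0 : 0 ≤ ρ := ENNReal.toReal_nonneg
  have hρ1' : ρ < 1 := by
    have := (ENNReal.toReal_lt_toReal (hρ1.trans ENNReal.one_lt_top).ne ENNReal.one_ne_top).2 hρ1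
    simpa using this
  obtain ⟨c, hc⟩ := (tendsto_pow_const_mul_const_pow_of_abs_lt_one (2 * B + p)
    (by rwa [abs_of_nonneg hρ0] : |ρ| < 1)).bddAbove_range
  have hc' (K : ℕ) : (K : ℝ) ^ (2 * B + p) * ρ ^ K ≤ c := hc ⟨K, rfl⟩
  have hc0 : 0 ≤ c := (by positivity : (0 : ℝ) ≤ _).trans (hc' 0)
  have hg0 : 0 ≤ g := ENNReal.toReal_nonneg
  refine ⟨d * (2 * g + c), by positivity, fun K hK => ?_⟩
  have hK1 : (1 : ℝ) ≤ K := by exact_mod_cast hK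
  have hK0 : (0 : ℝ) < K := by linarith
  have heq : (d * K ^ (2 * B) * (2 * (gaussianMoment N / K ^ N)
      + (1 - gaussianChance d ^ d) ^ K) : ℝ≥0∞)
      = ENNReal.ofReal (d * K ^ (2 * B) * (2 * (g / K ^ N) + ρ ^ K)) := by
    rw [ENNReal.ofReal_mul (by positivity), ENNReal.ofReal_mul (by positivity),
      ENNReal.ofReal_add (by positivity) (by positivity), ENNReal.ofReal_mul (by positivity),
      ENNReal.ofReal_div_of_pos (by positivity), ENNReal.ofReal_pow (by positivity),
      ENNReal.ofReal_pow (by positivity), ENNReal.ofReal_pow hρ0, hg, hρ]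
    simp
  rw [heq]
  refine ENNReal.ofReal_le_ofReal ?_
  rw [le_div_iff₀ (by positivity)]
  have h1 : (K : ℝ) ^ (2 * B + p) * (g / K ^ N) ≤ g := by
    have h2 : (K : ℝ) ^ (2 * B + p) * (g / K ^ N) = g / K ^ 8 := by
      rw [hN, pow_add _ (2 * B + p) 8]; field_simp
    rw [h2]
    exact div_le_self hg0 (one_le_pow₀ hK1)
  calc (d * K ^ (2 * B) * (2 * (g / K ^ N) + ρ ^ K) * K ^ p : ℝ)
      = d * (2 * (K ^ (2 * B + p) * (g / K ^ N)) + K ^ (2 * B + p) * ρ ^ K) := by ring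
    _ ≤ _ := by gcongr; exact hc' K

/-! ### The exceptional set and the conclusion -/

/-- The paths whose oscillations at the size `ε` are exceptional. -/
def oscillationSet (d m : ℕ) (ε : ℝ) : Set (Fin d → ℝ≥0 → ℝ) :=
  {w | scale m ε < threshold d m + 4 ∨ ¬ IsRegular (scale m ε) (2 * scaleExponent m + 1) w}

theorem one_le_scale (m : ℕ) {ε : ℝ} (hε : 0 < ε) : 1 ≤ scale m ε :=
  Nat.one_le_ceil_iff.2 (Real.rpow_pos_of_pos hε _)

theorem inv_scale_pow_le {m : ℕ} {ε : ℝ} (hε : 0 < ε) (hε1 : ε ≤ 1) (p : ℝ) :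
    1 ≤ (scale m ε : ℝ) ^ (⌈p⌉₊ * scaleExponent m) * ε ^ p := by
  have h1 := rpow_neg_le_scale_pow (m := m) hε ⌈p⌉₊
  calc (1 : ℝ) = ε ^ (-p) * ε ^ p := by rw [← Real.rpow_add hε]; simp
    _ ≤ ε ^ (-(⌈p⌉₊ : ℝ)) * ε ^ p := by
      gcongr ?_ * _
      exact Real.rpow_le_rpow_of_exponent_ge hε hε1 (neg_le_neg (Nat.le_ceil p))
    _ ≤ _ := by gcongr

/-- When the scale is below the threshold, every path is exceptional; but then `ε ^ p` is bounded
below, and the summand `K₀ ^ s` of the constant makes the bound at least one. Otherwise powers of `1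
/ scale m ε` convert into powers of `ε`. The constant is fixed before the probability space. -/
theorem exists_measure_oscillationSet_le (d m : ℕ) (p : ℝ) : ∃ C : ℝ,
    ∀ {Ω : Type*} [MeasurableSpace Ω] (P : Measure Ω) [IsProbabilityMeasure P]
      (W : Fin d → ℝ≥0 → Ω → ℝ), IsWienerFamily P W → ∀ ε : ℝ, 0 < ε → ε ≤ 1 →
      P {ω | (fun k t => W k t ω) ∈ oscillationSet d m ε} ≤ ENNReal.ofReal (C * ε ^ p) := by
  set s := ⌈p⌉₊ * scaleExponent m
  obtain ⟨C, hC0, hC⟩ := exists_irregularity_bound d (2 * scaleExponent m + 1) s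
  set K₀ := threshold d m + 4
  refine ⟨C + (K₀ : ℝ) ^ s, fun {Ω} _ P _ W hW ε hε hε1 => ?_⟩
  have hK := one_le_scale m hε
  have hKs := inv_scale_pow_le (m := m) hε hε1 p
  have hεp : 0 < ε ^ p := Real.rpow_pos_of_pos hε p
  by_cases hcase : scale m ε < K₀
  · refine prob_le_one.trans ?_
    rw [← ENNReal.ofReal_one]
    refine ENNReal.ofReal_le_ofReal (hKs.trans ?_)
    have : (scale m ε : ℝ) ≤ K₀ := by exact_mod_cast hcase.le
    have h2 : (scale m ε : ℝ) ^ s ≤ (K₀ : ℝ) ^ s := by gcongr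
    gcongr
    linarith
  · have hset : {ω | (fun k t => W k t ω) ∈ oscillationSet d m ε}
        = {ω | ¬ IsRegular (scale m ε) (2 * scaleExponent m + 1) (fun k t => W k t ω)} := by
      ext ω
      exact or_iff_right hcase
    rw [hset]
    refine (measure_not_isRegular_le hW hK (N := 2 * (2 * scaleExponent m + 1) + s + 8) (by omega)
      _).trans ((hC _ hK).trans (ENNReal.ofReal_le_ofReal ?_))
    have hK0 : (0 : ℝ) < scale m ε := by exact_mod_cast hK
    rw [div_le_iff₀ (by positivity)]
    calc C ≤ C * ((scale m ε : ℝ) ^ s * ε ^ p) := le_mul_of_one_le_right hC0 hKs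
      _ = C * ε ^ p * (scale m ε : ℝ) ^ s := by ring
      _ ≤ _ := by
        gcongr
        have : (0 : ℝ) ≤ (K₀ : ℝ) ^ s := by positivity
        linarith

theorem nullMeasurableSet_oscillationSet {Ω : Type*} [MeasurableSpace Ω] {P : Measure Ω}
    {W : Fin d → ℝ≥0 → Ω → ℝ} (hW : IsWienerFamily P W) (m : ℕ) (ε : ℝ) :
    NullMeasurableSet {ω | (fun k t => W k t ω) ∈ oscillationSet d m ε} P :=
  NullMeasurableSet.union (.const _) (nullMeasurableSet_isRegular hW _ _).compl

end WienerPoly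

theorem mainTheorem3 (d m : ℕ) :
    ∃ (Osc : ℝ → Set (Fin d → ℝ≥0 → ℝ)) (C : ℝ → ℝ),
      ∀ (Ω : Type*) [MeasurableSpace Ω] (P : Measure Ω) [IsProbabilityMeasure P]
        (W : Fin d → ℝ≥0 → Ω → ℝ), WienerPoly.IsWienerFamily P W →
        WienerPoly.IsNegligible P C (fun ε => {ω | (fun k t => W k t ω) ∈ Osc ε}) ∧
        ∀ A : Multiset (Fin d) → ℝ≥0 → Ω → ℝ,
          (∀ α, m < Multiset.card α → A α = 0) →
          WienerPoly.HoldsModulo (fun ε => {ω | (fun k t => W k t ω) ∈ Osc ε})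
            (fun ε ω =>
              WienerPoly.supNorm
                  (WienerPoly.wienerPolynomial (fun k t => W k t ω) (fun α t => A α t ω))
                ≤ ENNReal.ofReal ε →
              (⨆ α, WienerPoly.supNorm (fun t => A α t ω))
                  ≤ ENNReal.ofReal (ε ^ ((3 : ℝ) ^ (-(m : ℤ)))) ∨
              ENNReal.ofReal (ε ^ (-((3 : ℝ) ^ (-((m : ℤ) + 1)))))
                  ≤ ⨆ α, WienerPoly.lipNorm (fun t => A α t ω)) := by
  choose C hC using WienerPoly.exists_measure_oscillationSet_le d m
  refine ⟨WienerPoly.oscillationSet d m, C, fun Ω _ P _ W hW => ⟨fun ε hε hε1 =>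
    ⟨WienerPoly.nullMeasurableSet_oscillationSet hW m ε, fun p _ => hC p P W hW ε hε hε1⟩,
    fun A hA ε hε hε1 ω hω hZ => ?_⟩⟩
  obtain ⟨h1, h2⟩ := not_or.1 hω
  refine (not_not.1 h2).iSup_supNorm_le_or hε hε1 (not_lt.1 h1) (fun α hα => ?_) hZ
  ext t
  simp [hA α hα]
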